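/- **Model.** Let $[n]$ be a set of $n$ items. A valuation $v:2^{[n]}\to\mathbb R_{\ge 0}$ is unit-demand if $v(S)=\max_{i\in S}w_i$ for some $w\in\mathbb R_{\ge0}^n$ (with $v(\emptyset)=0$). An auction protocol consists of a (possibly infinite) binary tree whose internal nodes belong either to the buyer or to Chance, each Chance node carrying a probability distribution over its two children and each leaf carrying a bundle $Y\subseteq[n]$ and a payment $q\ge 0$, together with a suggested strategy for every buyer's type; a strategy is a choice of a child at every buyer's node. A type $v$ playing a strategy $\sigma$ has expected utility $\mathbb E[v(Y)]-\mathbb E[q]$ at the leaf that is reached. The protocol is individually rational if some strategy guarantees the empty allocation and expected payment $0$. For a prior $D$ on valuations and $\delta\ge 0$, it is $\delta$-almost truthful in expectation if it reaches a leaf with probability $1$ under every strategy, it is individually rational, and for every type $v$ in the support of $D$ no strategy has expected utility exceeding that of the suggested strategy of $v$ by more than $\delta$ (for $\delta=0$ it is truthful in expectation). Its revenue is the expected payment when $v\sim D$ plays its suggested strategy. $\mathrm{OPT}(D)$ is the supremum of the expected revenues of all incentive compatible, individually rational randomized direct mechanisms with non-negative payments for $D$. The protocol is $\tau$-approximate if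 its revenue is at least $\tau\cdot\mathrm{OPT}(D)$. **Theorem.** For every constant $\tau>0$ there are constants $c>0$, $\delta>0$ and $n_0\in\mathbb N$, depending only on $\tau$, such that for every $n\ge n_0$ there is a finitely supported (in general correlated) prior $D$ over unit-demand valuations on $n$ items with values in $[0,1]$ for which the following holds. Every $\tau$-approximate protocol that is $\delta$-almost truthful in expectation (in particular, every $\tau$-approximate truthful-in-expectation protocol) uses at least $c\,n$ bits of communication in expectation. This holds for the ex ante expectation, i.e. the expected depth of the leaf reached when $v\sim D$ plays its suggested strategy, and hence also for the expected depth under a worst-case strategy of the buyer. -/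

import Mathlib

open scoped ENNReal NNReal

noncomputable section

/-- A valuation: a non-negative value for every bundle of the `n` items. -/
abbrev BundleValuation (n : ℕ) : Type := Finset (Fin n) → ℝ≥0

/-- `v` is unit-demand: `v S` is the maximum over `i ∈ S` of non-negative item values `w i`
(and `0` for the empty bundle). -/
def IsUnitDemand {n : ℕ} (v : BundleValuation n) : Prop :=
  ∃ w : Fin n → ℝ≥0, ∀ S : Finset (Fin n), v S = S.sup w

/-! ### Direct-revelation mechanisms and the optimal revenue -/

/-- A (randomized) direct-revelation mechanism: for every reported type a lottery over bundles
and an expected payment. -/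
structure DirectMechanism (n : ℕ) where
  alloc : BundleValuation n → PMF (Finset (Fin n))
  pay : BundleValuation n → ℝ≥0

namespace DirectMechanism

variable {n : ℕ}

/-- Expected value, to a buyer with valuation `v`, of the lottery obtained by reporting `r`. -/
def expValue (M : DirectMechanism n) (v r : BundleValuation n) : ℝ≥0∞ :=
  ∑ S : Finset (Fin n), M.alloc r S * (v S : ℝ≥0∞)

/-- Incentive compatibility for the types of the prior `D`. All terms are finite, so that
`a + q ≤ b + p` is `a - p ≤ b - q`. -/
def IsIC (M : DirectMechanism n) (D : PMF (BundleValuation n)) : Prop :=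
  ∀ v ∈ D.support, ∀ r ∈ D.support,
    M.expValue v r + (M.pay v : ℝ≥0∞) ≤ M.expValue v v + (M.pay r : ℝ≥0∞)

/-- Interim individual rationality for the types of the prior `D`. -/
def IsIR (M : DirectMechanism n) (D : PMF (BundleValuation n)) : Prop :=
  ∀ v ∈ D.support, (M.pay v : ℝ≥0∞) ≤ M.expValue v v

/-- Expected revenue under truthful reports. -/
def revenue (M : DirectMechanism n) (D : PMF (BundleValuation n)) : ℝ≥0∞ :=
  ∑' v, D v * (M.pay v : ℝ≥0∞)

end DirectMechanism

/-- Optimal revenue: the supremum of the expected revenues of all incentive compatible and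
individually rational mechanisms. -/
def optimalRevenue {n : ℕ} (D : PMF (BundleValuation n)) : ℝ≥0∞ :=
  ⨆ (M : DirectMechanism n) (_ : M.IsIC D ∧ M.IsIR D), M.revenue D

/-! ### Auction protocols -/

/-- A node of a protocol tree: a buyer's node, a node of Chance with a distribution over its two
children, or a leaf with an allocated bundle and a payment. -/
inductive ProtocolNode (n : ℕ) where
  | buyer : ProtocolNode n
  | chance (p : PMF Bool) : ProtocolNode n
  | leaf (Y : Finset (Fin n)) (q : ℝ≥0) : ProtocolNode n

/-- A buyer's strategy: a choice of child at every history. Histories list the bits sent so far,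
the most recent one first. Only the choices at buyer's nodes matter. -/
abbrev BuyerStrategy : Type := List Bool → Bool

/-- An auction protocol: a possibly infinite binary tree, given by the label of the node at each
history (labels below a leaf are irrelevant), and a suggested strategy for every type. -/
structure AuctionProtocol (n : ℕ) where
  node : List Bool → ProtocolNode n
  suggested : BundleValuation n → BuyerStrategy

namespace AuctionProtocol

variable {n : ℕ}

/-- Probability that the node `x` is followed by the bit `b` when the buyer would choose `a`. -/
def stepProb (x : ProtocolNode n) (a b : Bool) : ℝ≥0∞ :=
  match x with
  | .buyer => if a = b then 1 else 0
  | .chance p => p b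
  | .leaf _ _ => 0

/-- Probability that the protocol reaches the node at history `h` under the strategy `σ`. -/
def reachProb (P : AuctionProtocol n) (σ : BuyerStrategy) : List Bool → ℝ≥0∞
  | [] => 1
  | b :: h => P.reachProb σ h * stepProb (P.node h) (σ h) b

/-- Expectation of `f` (a function of the history, the allocation and the payment) at the leaf
reached under the strategy `σ`. -/
def leafExp (P : AuctionProtocol n) (σ : BuyerStrategy)
    (f : List Bool → Finset (Fin n) → ℝ≥0 → ℝ≥0∞) : ℝ≥0∞ :=
  ∑' h : List Bool,
    match P.node h with
    | .leaf Y q => P.reachProb σ h * f h Y q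
    | _ => 0

/-- Expected value of the allocation for a buyer with valuation `v` under the strategy `σ`. -/
def expValue (P : AuctionProtocol n) (v : BundleValuation n) (σ : BuyerStrategy) : ℝ≥0∞ :=
  P.leafExp σ fun _ Y _ => (v Y : ℝ≥0∞)

/-- Expected payment under the strategy `σ`; it may be infinite. -/
def expPayment (P : AuctionProtocol n) (σ : BuyerStrategy) : ℝ≥0∞ :=
  P.leafExp σ fun _ _ q => (q : ℝ≥0∞)

/-- Expected number of bits sent (depth of the leaf reached) under the strategy `σ`. -/
def expBits (P : AuctionProtocol n) (σ : BuyerStrategy) : ℝ≥0∞ :=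
  P.leafExp σ fun h _ _ => (h.length : ℝ≥0∞)

/-- The protocol ends at a leaf with probability one, whatever the buyer's strategy. -/
def IsFinite (P : AuctionProtocol n) : Prop :=
  ∀ σ : BuyerStrategy, P.leafExp σ (fun _ _ _ => 1) = 1

/-- Individual rationality: some strategy guarantees expected payment zero and the empty
allocation. -/
def IsIR (P : AuctionProtocol n) : Prop :=
  ∃ σ : BuyerStrategy, P.expPayment σ = 0 ∧
    ∀ (h : List Bool) (Y : Finset (Fin n)) (q : ℝ≥0),
      P.node h = .leaf Y q → P.reachProb σ h ≠ 0 → Y = ∅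

/-- `δ`-almost truthful in expectation for the prior `D`: the protocol is finite and individually
rational, and for no type in the support of `D` does any strategy give an expected utility (value
minus payment) that exceeds that of the suggested one by more than `δ`. Expected values are finite,
and so are, by individual rationality, the expected payments of the suggested strategies, so that
the inequality without subtraction says this, also against strategies of infinite payment. The
case `δ = 0` is exact incentive compatibility. -/
def IsAlmostIC (P : AuctionProtocol n) (D : PMF (BundleValuation n)) (δ : ℝ≥0) : Prop :=
  P.IsFinite ∧ P.IsIR ∧
    ∀ v ∈ D.support, ∀ σ : BuyerStrategy,
      P.expValue v σ + P.expPayment (P.suggested v) ≤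
        P.expValue v (P.suggested v) + P.expPayment σ + (δ : ℝ≥0∞)

/-- Expected revenue when the buyer's type is drawn from `D` and he plays the suggested strategy. -/
def revenue (P : AuctionProtocol n) (D : PMF (BundleValuation n)) : ℝ≥0∞ :=
  ∑' v, D v * P.expPayment (P.suggested v)

/-- Ex ante expected communication: the expected number of bits sent when the buyer's type is drawn
from `D` and he plays the suggested strategy. -/
def exAnteBits (P : AuctionProtocol n) (D : PMF (BundleValuation n)) : ℝ≥0∞ :=
  ∑' v, D v * P.expBits (P.suggested v)

/-- Expected communication complexity: the expected number of bits sent under a worst-case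
strategy of the buyer. -/
def commComplexity (P : AuctionProtocol n) : ℝ≥0∞ :=
  ⨆ σ : BuyerStrategy, P.expBits σ

end AuctionProtocol

end

/-!
A type is a pair of a set `A k` of items and a value `x k`: the buyer wants one item of `A k` and
values it at `x k` (`hitVal`). The sets come from a binary code with at least `16 ^ q` words,
`q = n / 32`, such that any two of the sets have at most seven eighths of their items in common.
The value is one of `1, 1/2, …, 2⁻ᴷ`, with `K` depending on `τ` only, and is determined by `k`;
the prior is uniform over `k`.

The optimal revenue is a constant fraction of the average of `x k`: a uniformly random item of
`A k` is offered for an eighth of `x k`, and a type that reports another set loses at least that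
much in value (`le_optimalRevenue_hitPrior`). If `x k` were drawn from the equal-revenue
distribution, in which `2⁻ˡ` has a probability proportional to `2ˡ`, that average would be about
`K` times the `O(2⁻ᴷ)` that a mechanism that knows `A k` but not `x k` can extract. It remains to
choose the values `x k` such that no protocol that uses few bits can tell them from random ones.

For a protocol cut off at depth `m`, let `C k y` be the least expectation of payment plus lost
value over all strategies of a buyer who values the items of `A k` at `y` (`truncCost`). If the
protocol is almost truthful, then the payment of type `k` is at most about
`2 * C k (x k) - C k (2 * x k)`, since a type with the value `2 * x k` may imitate it
(`expPayment_add_truncCost_le`). Under the equal-revenue distribution the expectation of this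
bound telescopes (`sum_levelWeight_mul_virtual`). The function `C` is computed by a binary tree of
depth `m`, with minima at the buyer's nodes and averages at the nodes of Chance. Therefore, up to
additive constants, which do not matter, it is close to one of `2 ^ (O(n) * 2 ^ m)` functions
(`isNear_truncCost`, `card_treeNet_le`). For `m = q` the number of types is much larger than the
logarithm of this number, and a union bound over exponential moments gives values `x k` that work
for all of these functions at once (`exists_levels`). By Markov's inequality, a protocol that uses
fewer than `c * n` bits on average is hardly affected by the cut at depth `q`
(`mul_runProb_le_expBits`), and so its revenue is `O(2⁻ᴷ)`.
-/

open scoped ENNReal NNReal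

/-! ### Expectations over the leaves of a protocol -/

/-- What remains of a strategy after the first bit `b`. -/
def BuyerStrategy.sub (σ : BuyerStrategy) (b : Bool) : BuyerStrategy := fun h => σ (h ++ [b])

/-- The strategy that chooses `a` at the root and follows `s b` after the first bit `b`. -/
def BuyerStrategy.glue (a : Bool) (s : Bool → BuyerStrategy) : BuyerStrategy :=
  fun h => match h.getLast? with
    | none => a
    | some b => s b h.dropLast

@[simp] lemma BuyerStrategy.glue_nil (a : Bool) (s : Bool → BuyerStrategy) :
    BuyerStrategy.glue a s [] = a := rfl

@[simp] lemma BuyerStrategy.glue_sub (a : Bool) (s : Bool → BuyerStrategy) (b : Bool) :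
    (BuyerStrategy.glue a s).sub b = s b := by
  funext h
  simp [BuyerStrategy.glue, BuyerStrategy.sub]

lemma tsum_list_snoc (F : List Bool → ℝ≥0∞) :
    ∑' h, F h = F [] + ∑ b, ∑' h, F (h ++ [b]) := by
  let e : Option (Bool × List Bool) → List Bool := fun o => o.elim [] fun x => x.2 ++ [x.1]
  have he : Function.Bijective e := by
    constructor
    · rintro (_ | ⟨b, h⟩) (_ | ⟨b', h'⟩) H
      · rfl
      · simp [e] at H
      · simp [e] at H
      · have := List.append_inj' (show h ++ [b] = h' ++ [b'] from H) rfl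
        simp_all
    · intro h
      rcases List.eq_nil_or_concat h with rfl | ⟨l, b, rfl⟩
      · exact ⟨none, rfl⟩
      · exact ⟨some (b, l), by simp [e]⟩
  rw [← (Equiv.ofBijective e he).tsum_eq F,
    ← (Equiv.optionEquivSumPUnit.{0} (Bool × List Bool)).symm.tsum_eq,
    Summable.tsum_sum ENNReal.summable ENNReal.summable, add_comm, tsum_fintype,
    ← tsum_fintype (L := .unconditional _) (fun b => ∑' h, F (h ++ [b])), ← ENNReal.tsum_prod]
  simp [e]

namespace ProtocolNode

variable {n : ℕ}

/-- `g` of the bundle and the payment at a leaf, and `0` at an internal node. -/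
def onLeaf (x : ProtocolNode n) (g : Finset (Fin n) → ℝ≥0 → ℝ≥0∞) : ℝ≥0∞ :=
  match x with
  | .leaf Y q => g Y q
  | _ => 0

lemma onLeaf_leaf (Y : Finset (Fin n)) (q : ℝ≥0)
    (g : Finset (Fin n) → ℝ≥0 → ℝ≥0∞) : (ProtocolNode.leaf Y q).onLeaf g = g Y q := rfl

lemma onLeaf_of_not_leaf {x : ProtocolNode n} (hx : ∀ Y q, x ≠ .leaf Y q)
    (g : Finset (Fin n) → ℝ≥0 → ℝ≥0∞) : x.onLeaf g = 0 := by
  cases x with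
  | leaf Y q => exact absurd rfl (hx Y q)
  | _ => rfl

lemma onLeaf_zero (x : ProtocolNode n) :
    (x.onLeaf fun _ _ => 0) = 0 := by
  cases x <;> rfl

lemma onLeaf_mono (x : ProtocolNode n)
    {f g : Finset (Fin n) → ℝ≥0 → ℝ≥0∞} (h : ∀ Y q, f Y q ≤ g Y q) : x.onLeaf f ≤ x.onLeaf g := by
  cases x <;> simp [ProtocolNode.onLeaf, h]

lemma onLeaf_add (x : ProtocolNode n) (f g : Finset (Fin n) → ℝ≥0 → ℝ≥0∞) :
    (x.onLeaf fun Y q => f Y q + g Y q) = x.onLeaf f + x.onLeaf g := by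
  cases x <;> simp [ProtocolNode.onLeaf]

lemma onLeaf_const_mul (x : ProtocolNode n) (c : ℝ≥0∞)
    (f : Finset (Fin n) → ℝ≥0 → ℝ≥0∞) : (x.onLeaf fun Y q => c * f Y q) = c * x.onLeaf f := by
  cases x <;> simp [ProtocolNode.onLeaf]

end ProtocolNode

namespace AuctionProtocol

variable {n : ℕ}

/-- The protocol that remains after the first bit `b`. Histories list the most recent bit first,
so the first bit stands at the end. -/
def sub (P : AuctionProtocol n) (b : Bool) : AuctionProtocol n where
  node h := P.node (h ++ [b])
  suggested := P.suggested

lemma leafExp_def (P : AuctionProtocol n) (σ : BuyerStrategy)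
    (f : List Bool → Finset (Fin n) → ℝ≥0 → ℝ≥0∞) :
    P.leafExp σ f = ∑' h, (P.node h).onLeaf fun Y q => P.reachProb σ h * f h Y q := rfl

lemma reachProb_snoc (P : AuctionProtocol n) (σ : BuyerStrategy) (h : List Bool) (b : Bool) :
    P.reachProb σ (h ++ [b]) =
      stepProb (P.node []) (σ []) b * (P.sub b).reachProb (σ.sub b) h := by
  induction h with
  | nil => simp [reachProb]
  | cons a h ih =>
    rw [List.cons_append, reachProb, reachProb, ih, mul_assoc]
    rfl

lemma leafExp_of_leaf {P : AuctionProtocol n} {Y : Finset (Fin n)} {q : ℝ≥0}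
    (hP : P.node [] = .leaf Y q) (σ : BuyerStrategy)
    (f : List Bool → Finset (Fin n) → ℝ≥0 → ℝ≥0∞) : P.leafExp σ f = f [] Y q := by
  have : ∀ b : Bool, ∀ h : List Bool, P.reachProb σ (h ++ [b]) = 0 := by
    intro b h
    rw [reachProb_snoc, hP]
    simp [stepProb]
  rw [leafExp_def, tsum_list_snoc, hP]
  simp [this, ProtocolNode.onLeaf_leaf, ProtocolNode.onLeaf_zero, reachProb]

lemma leafExp_of_not_leaf {P : AuctionProtocol n} (hP : ∀ Y q, P.node [] ≠ .leaf Y q)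
    (σ : BuyerStrategy) (f : List Bool → Finset (Fin n) → ℝ≥0 → ℝ≥0∞) :
    P.leafExp σ f = ∑ b, stepProb (P.node []) (σ []) b *
      (P.sub b).leafExp (σ.sub b) fun h => f (h ++ [b]) := by
  rw [leafExp_def, tsum_list_snoc, ProtocolNode.onLeaf_of_not_leaf hP, zero_add]
  refine Finset.sum_congr rfl fun b _ => ?_
  rw [leafExp_def, ← ENNReal.tsum_mul_left]
  refine tsum_congr fun h => ?_
  rw [← ProtocolNode.onLeaf_const_mul]
  simp only [reachProb_snoc, mul_assoc]
  rfl

lemma leafExp_mono (P : AuctionProtocol n) (σ : BuyerStrategy)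
    {f g : List Bool → Finset (Fin n) → ℝ≥0 → ℝ≥0∞} (h : ∀ l Y q, f l Y q ≤ g l Y q) :
    P.leafExp σ f ≤ P.leafExp σ g :=
  ENNReal.tsum_le_tsum fun l =>
    ProtocolNode.onLeaf_mono _ fun Y q => mul_le_mul_right (h l Y q) _

lemma leafExp_add (P : AuctionProtocol n) (σ : BuyerStrategy)
    (f g : List Bool → Finset (Fin n) → ℝ≥0 → ℝ≥0∞) :
    P.leafExp σ (fun l Y q => f l Y q + g l Y q) = P.leafExp σ f + P.leafExp σ g := by
  simp only [leafExp_def, ← ENNReal.tsum_add, mul_add, ProtocolNode.onLeaf_add]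

lemma leafExp_const_mul (P : AuctionProtocol n) (σ : BuyerStrategy) (c : ℝ≥0∞)
    (f : List Bool → Finset (Fin n) → ℝ≥0 → ℝ≥0∞) :
    P.leafExp σ (fun l Y q => c * f l Y q) = c * P.leafExp σ f := by
  simp only [leafExp_def, ← ENNReal.tsum_mul_left, mul_left_comm _ c,
    ProtocolNode.onLeaf_const_mul]

lemma sum_stepProb {P : AuctionProtocol n} (hP : ∀ Y q, P.node [] ≠ .leaf Y q) (a : Bool) :
    ∑ b, stepProb (P.node []) a b = 1 := by
  cases hn : P.node [] with
  | leaf Y q => exact absurd hn (hP Y q)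
  | buyer => simp [stepProb]
  | chance p => simpa [stepProb, tsum_fintype] using p.tsum_coe

/-! ### Costs and truncation -/

open Classical in
/-- Probability that no leaf has been reached after `m` bits. -/
noncomputable def runProb : ℕ → AuctionProtocol n → BuyerStrategy → ℝ≥0∞
  | 0, P, _ => if ∃ Y q, P.node [] = .leaf Y q then 0 else 1
  | m + 1, P, σ => ∑ b, stepProb (P.node []) (σ []) b * runProb m (P.sub b) (σ.sub b)

lemma leafExp_length_le_add_runProb (m : ℕ) (P : AuctionProtocol n) (σ : BuyerStrategy) :
    (P.leafExp σ fun h _ _ => if h.length ≤ m then 1 else 0) + runProb m P σ = 1 := by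
  induction m generalizing P σ with
  | zero =>
    by_cases hP : ∃ Y q, P.node [] = .leaf Y q
    · obtain ⟨Y, q, hP'⟩ := hP
      simp [leafExp_of_leaf hP', runProb, hP']
    · have hP' := hP
      push Not at hP'
      rw [leafExp_of_not_leaf hP', runProb, if_neg hP]
      simp [leafExp_def, ProtocolNode.onLeaf_zero]
  | succ m ih =>
    by_cases hP : ∃ Y q, P.node [] = .leaf Y q
    · obtain ⟨Y, q, hP'⟩ := hP
      simp [leafExp_of_leaf hP', runProb, hP', stepProb]
    · push Not at hP
      rw [leafExp_of_not_leaf hP, runProb, ← Finset.sum_add_distrib]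
      refine (Finset.sum_congr rfl fun b _ => ?_).trans (sum_stepProb hP (σ []))
      rw [← mul_add]
      simp [ih]

lemma leafExp_length_le_le_one (m : ℕ) (P : AuctionProtocol n) (σ : BuyerStrategy) :
    (P.leafExp σ fun h _ _ => if h.length ≤ m then 1 else 0) ≤ 1 :=
  le_self_add.trans_eq (leafExp_length_le_add_runProb m P σ)

lemma leafExp_one_le (P : AuctionProtocol n) (σ : BuyerStrategy) :
    P.leafExp σ (fun _ _ _ => 1) ≤ 1 := by
  rw [leafExp_def, ENNReal.tsum_eq_iSup_sum]
  refine iSup_le fun s => ?_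
  refine le_trans (Finset.sum_le_sum fun h hh => ?_) ((ENNReal.sum_le_tsum s).trans
    ((leafExp_def P σ _).symm.trans_le (leafExp_length_le_le_one (s.sup List.length) P σ)))
  simp only [if_pos (Finset.le_sup (f := List.length) hh), le_refl]

/-- Markov's inequality for the number of bits. -/
lemma mul_runProb_le_expBits {P : AuctionProtocol n} (hP : P.IsFinite) (m : ℕ)
    (σ : BuyerStrategy) : (m : ℝ≥0∞) * runProb m P σ ≤ P.expBits σ := by
  have h1 := leafExp_length_le_add_runProb m P σ
  have h2 : (P.leafExp σ fun h _ _ => if h.length ≤ m then 1 else 0) +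
      (P.leafExp σ fun h _ _ => if h.length ≤ m then 0 else 1) = 1 := by
    rw [← leafExp_add]
    refine Eq.trans (congrArg _ ?_) (hP σ)
    funext h _ _
    split <;> simp
  have h3 : runProb m P σ = P.leafExp σ fun h _ _ => if h.length ≤ m then 0 else 1 := by
    refine (ENNReal.add_right_inj ?_).1 (h1.trans h2.symm)
    exact ne_top_of_le_ne_top ENNReal.one_ne_top (leafExp_length_le_le_one m P σ)
  rw [h3, ← leafExp_const_mul]
  refine leafExp_mono _ _ fun l _ _ => ?_
  split
  · simp
  · rw [mul_one]
    exact_mod_cast (by omega : m ≤ l.length)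

/-- Indicator of the event that the bundle `Y` contains no item of `A`. -/
noncomputable def miss (A Y : Finset (Fin n)) : ℝ≥0∞ := if Disjoint Y A then 1 else 0

lemma miss_le_one (A Y : Finset (Fin n)) : miss A Y ≤ 1 := by
  unfold miss
  split <;> simp

/-- Expected payment plus `y` times the probability of receiving no item of `A`. For a buyer who
values every bundle that meets `A` at `y`, this is `y` minus his expected utility; unlike the
utility it is never negative. -/
noncomputable def cost (P : AuctionProtocol n) (A : Finset (Fin n)) (y : ℝ≥0)
    (σ : BuyerStrategy) : ℝ≥0∞ :=
  P.leafExp σ fun _ Y q => q + y * miss A Y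

lemma cost_eq (P : AuctionProtocol n) (A : Finset (Fin n)) (y : ℝ≥0) (σ : BuyerStrategy) :
    P.cost A y σ = P.expPayment σ + y * P.leafExp σ fun _ Y _ => miss A Y := by
  rw [cost, leafExp_add, expPayment, leafExp_const_mul]

lemma cost_le (P : AuctionProtocol n) (A : Finset (Fin n)) (y : ℝ≥0) (σ : BuyerStrategy) :
    P.cost A y σ ≤ P.expPayment σ + y := by
  rw [cost_eq]
  refine add_le_add_right ?_ _
  calc (y : ℝ≥0∞) * P.leafExp σ (fun _ Y _ => miss A Y) ≤ y * 1 := by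
        gcongr
        exact (leafExp_mono _ _ fun _ Y _ => miss_le_one A Y).trans (leafExp_one_le P σ)
    _ = y := mul_one _

/-- Least cost in the protocol cut off after `m` bits. At a node where it is cut off, no item is
allocated and the least payment that the buyer can achieve from there on is due. Cutting off in this
way does not lower the least cost, and it raises the cost of a strategy at most by the value that
the strategy obtains after more than `m` bits. -/
noncomputable def truncCost (A : Finset (Fin n)) (y : ℝ≥0) : ℕ → AuctionProtocol n → ℝ≥0∞
  | 0, P => match P.node [] with
    | .leaf Y q => q + y * miss A Y
    | _ => (⨅ σ, P.expPayment σ) + y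
  | m + 1, P => match P.node [] with
    | .leaf Y q => q + y * miss A Y
    | .buyer => ⨅ b, truncCost A y m (P.sub b)
    | .chance p => ∑ b, p b * truncCost A y m (P.sub b)

lemma truncCost_of_leaf {P : AuctionProtocol n} {Y : Finset (Fin n)} {q : ℝ≥0}
    (hP : P.node [] = .leaf Y q) (A : Finset (Fin n)) (y : ℝ≥0) (m : ℕ) :
    truncCost A y m P = q + y * miss A Y := by
  cases m <;> simp only [truncCost, hP]

lemma truncCost_zero {P : AuctionProtocol n} (hP : ∀ Y q, P.node [] ≠ .leaf Y q)
    (A : Finset (Fin n)) (y : ℝ≥0) : truncCost A y 0 P = (⨅ σ, P.expPayment σ) + y := by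
  cases hn : P.node [] with
  | leaf Y q => exact absurd hn (hP Y q)
  | _ => simp only [truncCost, hn]

lemma truncCost_le (A : Finset (Fin n)) (y : ℝ≥0) (m : ℕ) (P : AuctionProtocol n)
    (σ : BuyerStrategy) : truncCost A y m P ≤ P.cost A y σ + y * runProb m P σ := by
  induction m generalizing P σ with
  | zero =>
    by_cases hP : ∃ Y q, P.node [] = .leaf Y q
    · obtain ⟨Y, q, hP⟩ := hP
      rw [truncCost_of_leaf hP, cost, leafExp_of_leaf hP]
      exact le_self_add
    · have hP' := hP
      push Not at hP'
      rw [truncCost_zero hP', runProb, if_neg hP, mul_one]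
      gcongr
      refine (iInf_le _ σ).trans ?_
      rw [cost_eq]
      exact le_self_add
  | succ m ih =>
    have key : ∀ b, stepProb (P.node []) (σ []) b * truncCost A y m (P.sub b) ≤
        stepProb (P.node []) (σ []) b * (P.sub b).cost A y (σ.sub b) +
          y * (stepProb (P.node []) (σ []) b * runProb m (P.sub b) (σ.sub b)) := by
      intro b
      rw [mul_left_comm (y : ℝ≥0∞), ← mul_add]
      gcongr
      exact ih _ _
    have hsum := Finset.sum_le_sum fun b (_ : b ∈ Finset.univ) => key b
    rw [Finset.sum_add_distrib, ← Finset.mul_sum] at hsum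
    cases hn : P.node [] with
    | leaf Y q =>
      rw [truncCost_of_leaf hn, cost, leafExp_of_leaf hn]
      exact le_self_add
    | buyer =>
      rw [runProb, cost, leafExp_of_not_leaf (by simp [hn])]
      refine le_trans ?_ hsum
      simp only [truncCost, hn]
      refine (iInf_le _ (σ [])).trans ?_
      simp [stepProb]
    | chance p =>
      rw [runProb, cost, leafExp_of_not_leaf (by simp [hn])]
      refine le_trans ?_ hsum
      simp only [truncCost, hn]
      simp [stepProb]

lemma iInf_cost_le_truncCost (A : Finset (Fin n)) (y : ℝ≥0) (m : ℕ) (P : AuctionProtocol n) :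
    ⨅ σ, P.cost A y σ ≤ truncCost A y m P := by
  induction m generalizing P with
  | zero =>
    by_cases hP : ∃ Y q, P.node [] = .leaf Y q
    · obtain ⟨Y, q, hP⟩ := hP
      rw [truncCost_of_leaf hP]
      refine (iInf_le _ fun _ => true).trans ?_
      rw [cost, leafExp_of_leaf hP]
    · push Not at hP
      rw [truncCost_zero hP, ENNReal.iInf_add]
      exact iInf_mono fun σ => cost_le P A y σ
  | succ m ih =>
    cases hn : P.node [] with
    | leaf Y q =>
      rw [truncCost_of_leaf hn]
      refine (iInf_le _ fun _ => true).trans ?_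
      rw [cost, leafExp_of_leaf hn]
    | buyer =>
      simp only [truncCost, hn]
      refine le_iInf fun b => le_trans (le_iInf fun σ => ?_) (ih (P.sub b))
      refine (iInf_le _ (BuyerStrategy.glue b fun _ => σ)).trans ?_
      rw [cost, leafExp_of_not_leaf (by simp [hn]), hn]
      cases b <;> simp [stepProb, cost]
    | chance p =>
      simp only [truncCost, hn]
      refine le_trans ?_ (Finset.sum_le_sum fun b _ => mul_le_mul_right (ih (P.sub b)) (p b))
      rw [Fintype.sum_bool, ENNReal.mul_iInf (fun h => absurd h (p.apply_ne_top _)),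
        ENNReal.mul_iInf (fun h => absurd h (p.apply_ne_top _)), ENNReal.iInf_add]
      refine le_iInf fun σ₁ => ?_
      rw [ENNReal.add_iInf]
      refine le_iInf fun σ₂ => ?_
      refine (iInf_le _ (BuyerStrategy.glue true fun b => bif b then σ₁ else σ₂)).trans ?_
      rw [cost, leafExp_of_not_leaf (by simp [hn]), hn]
      simp [stepProb, cost]

end AuctionProtocol

/-! ### A finite net for the truncated costs -/

section Net

variable {Θ : Type*}

open scoped Classical

/-- Finite approximations to the functions that binary trees of depth `m` compute from leaf
functions in `F` by minima and averages. Only functions up to additive constants are represented,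
so that in a minimum the offset between the two arguments may be taken in `[0, 2]`; the offsets and
the averaging weights are restricted to a grid of `J + 1` points. -/
noncomputable def treeNet (F : Finset (Θ → ℝ)) (J : ℕ) : ℕ → Finset (Θ → ℝ)
  | 0 => F
  | m + 1 =>
    ((treeNet F J m ×ˢ treeNet F J m) ×ˢ (Finset.univ : Finset (Fin (J + 1)))).image
        (fun x θ => min (x.1.1 θ) (2 * ((x.2 : ℕ) / J : ℝ) + x.1.2 θ)) ∪
      ((treeNet F J m ×ˢ treeNet F J m) ×ˢ (Finset.univ : Finset (Fin (J + 1)))).image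
        (fun x θ => ((x.2 : ℕ) / J : ℝ) * x.1.1 θ + (1 - ((x.2 : ℕ) / J : ℝ)) * x.1.2 θ)

lemma min_mem_treeNet {F : Finset (Θ → ℝ)} {J m : ℕ} {f g : Θ → ℝ} (hf : f ∈ treeNet F J m)
    (hg : g ∈ treeNet F J m) (i : Fin (J + 1)) :
    (fun θ => min (f θ) (2 * ((i : ℕ) / J : ℝ) + g θ)) ∈ treeNet F J (m + 1) :=
  Finset.mem_union_left _ (Finset.mem_image.2 ⟨((f, g), i), by simp [hf, hg], rfl⟩)

lemma mix_mem_treeNet {F : Finset (Θ → ℝ)} {J m : ℕ} {f g : Θ → ℝ} (hf : f ∈ treeNet F J m)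
    (hg : g ∈ treeNet F J m) (i : Fin (J + 1)) :
    (fun θ => ((i : ℕ) / J : ℝ) * f θ + (1 - ((i : ℕ) / J : ℝ)) * g θ) ∈ treeNet F J (m + 1) :=
  Finset.mem_union_right _ (Finset.mem_image.2 ⟨((f, g), i), by simp [hf, hg], rfl⟩)

lemma treeNet_subset_succ (F : Finset (Θ → ℝ)) (J m : ℕ) :
    treeNet F J m ⊆ treeNet F J (m + 1) := by
  intro f hf
  have := min_mem_treeNet hf hf (0 : Fin (J + 1))
  simpa using this

lemma treeNet_mem_Icc {F : Finset (Θ → ℝ)} (hF : ∀ f ∈ F, ∀ θ, f θ ∈ Set.Icc (0 : ℝ) 2) {J : ℕ}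
    (m : ℕ) : ∀ f ∈ treeNet F J m, ∀ θ, f θ ∈ Set.Icc (0 : ℝ) 2 := by
  induction m with
  | zero => exact hF
  | succ m ih =>
    intro f hf θ
    simp only [treeNet, Finset.mem_union, Finset.mem_image, Finset.mem_product, Finset.mem_univ,
      and_true] at hf
    rcases hf with ⟨⟨⟨g, h⟩, i⟩, ⟨hg, hh⟩, rfl⟩ | ⟨⟨⟨g, h⟩, i⟩, ⟨hg, hh⟩, rfl⟩
    · have h1 := ih g hg θ
      have h2 := ih h hh θ
      have h3 : (0 : ℝ) ≤ ((i : ℕ) / J : ℝ) := by positivity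
      exact ⟨le_min h1.1 (by linarith [h2.1]), (min_le_left _ _).trans h1.2⟩
    · have h3 : (0 : ℝ) ≤ ((i : ℕ) / J : ℝ) := by positivity
      have h4 : ((i : ℕ) / J : ℝ) ≤ 1 := by
        refine div_le_one_of_le₀ ?_ (Nat.cast_nonneg J)
        exact_mod_cast Nat.lt_succ_iff.1 i.2
      exact (convex_Icc (0 : ℝ) 2) (ih g hg θ) (ih h hh θ) h3 (by linarith) (by ring)

lemma card_treeNet_le (F : Finset (Θ → ℝ)) (J m : ℕ) :
    2 * (J + 1) * (treeNet F J m).card ≤ (2 * (J + 1) * F.card) ^ 2 ^ m := by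
  induction m with
  | zero => simp [treeNet]
  | succ m ih =>
    have h1 : (treeNet F J (m + 1)).card ≤ 2 * (J + 1) * (treeNet F J m).card ^ 2 := by
      refine (Finset.card_union_le _ _).trans ?_
      refine (add_le_add Finset.card_image_le Finset.card_image_le).trans ?_
      simp only [Finset.card_product, Finset.card_univ, Fintype.card_fin]
      exact le_of_eq (by ring)
    calc 2 * (J + 1) * (treeNet F J (m + 1)).card
        ≤ 2 * (J + 1) * (2 * (J + 1) * (treeNet F J m).card ^ 2) := Nat.mul_le_mul_left _ h1
      _ = (2 * (J + 1) * (treeNet F J m).card) ^ 2 := by ring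
      _ ≤ ((2 * (J + 1) * F.card) ^ 2 ^ m) ^ 2 := Nat.pow_le_pow_left ih 2
      _ = _ := by rw [← pow_mul, pow_succ]

lemma exists_grid_near {J : ℕ} (hJ : 0 < J) {x : ℝ} (h0 : 0 ≤ x) (h1 : x ≤ 1) :
    ∃ i : Fin (J + 1), |x - ((i : ℕ) / J : ℝ)| ≤ 1 / J := by
  have hJ' : (0 : ℝ) < J := by exact_mod_cast hJ
  have hx : 0 ≤ x * J := by positivity
  refine ⟨⟨⌊x * J⌋₊, Nat.lt_succ_iff.2 (Nat.floor_le_of_le ?_)⟩, ?_⟩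
  · nlinarith
  · have h2 := Nat.floor_le hx
    have h3 := Nat.lt_floor_add_one (x * J)
    simp only
    rw [abs_le, ← sub_nonneg, ← sub_nonneg (b := x - _)]
    have e1 : x - (⌊x * J⌋₊ : ℝ) / J - -(1 / J) = (x * J - ⌊x * J⌋₊ + 1) / J := by
      field_simp
      ring
    have e2 : 1 / J - (x - (⌊x * J⌋₊ : ℝ) / J) = (⌊x * J⌋₊ + 1 - x * J) / J := by
      field_simp
      ring
    rw [e1, e2]
    exact ⟨div_nonneg (by linarith) hJ'.le, div_nonneg (by linarith) hJ'.le⟩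

/-- Up to an additive constant `C` is finite and within `ε` of a member of `S`, unless it is
infinite throughout. -/
def IsNear (S : Finset (Θ → ℝ)) (ε : ℝ) (C : Θ → ℝ≥0∞) : Prop :=
  (∀ θ, C θ = ∞) ∨ ∃ c : ℝ, ∃ f ∈ S, ∀ θ, C θ ≠ ∞ ∧ |(C θ).toReal - (c + f θ)| ≤ ε

lemma IsNear.mono {S T : Finset (Θ → ℝ)} {ε ε' : ℝ} {C : Θ → ℝ≥0∞} (h : IsNear S ε C)
    (hST : S ⊆ T) (hε : ε ≤ ε') : IsNear T ε' C := by
  rcases h with h | ⟨c, f, hf, h⟩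
  · exact .inl h
  · exact .inr ⟨c, f, hST hf, fun θ => ⟨(h θ).1, (h θ).2.trans hε⟩⟩

lemma IsNear.min {F : Finset (Θ → ℝ)} (hF : ∀ f ∈ F, ∀ θ, f θ ∈ Set.Icc (0 : ℝ) 2) {J : ℕ}
    (hJ : 0 < J) {m : ℕ} {ε : ℝ} {C D : Θ → ℝ≥0∞} (hC : IsNear (treeNet F J m) ε C)
    (hD : IsNear (treeNet F J m) ε D) :
    IsNear (treeNet F J (m + 1)) (ε + 2 / J) fun θ => min (C θ) (D θ) := by
  have hJ' : (0 : ℝ) ≤ 2 / J := by positivity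
  rcases hC with hC | ⟨c, f, hf, hC⟩
  · simpa [hC] using hD.mono (treeNet_subset_succ F J m) (by linarith)
  rcases hD with hD | ⟨d, g, hg, hD⟩
  · simpa [hD] using IsNear.mono (.inr ⟨c, f, hf, hC⟩) (treeNet_subset_succ F J m)
      (by linarith : ε ≤ ε + 2 / J)
  wlog hcd : c ≤ d generalizing C D c d f g
  · simpa only [min_comm] using this d g hg hD c f hf hC (le_of_not_ge hcd)
  obtain ⟨i, hi⟩ := exists_grid_near hJ (x := Min.min (d - c) 2 / 2)
    (by have : 0 ≤ Min.min (d - c) 2 := le_min (by linarith) (by norm_num)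
        positivity)
    (by have := min_le_right (d - c) 2
        linarith)
  refine .inr ⟨c, _, min_mem_treeNet hf hg i, fun θ => ⟨?_, ?_⟩⟩
  · exact ne_top_of_le_ne_top (hC θ).1 (min_le_left _ _)
  · rw [ENNReal.toReal_min (hC θ).1 (hD θ).1]
    have hfθ := treeNet_mem_Icc hF m f hf θ
    have hgθ := treeNet_mem_Icc hF m g hg θ
    have h1 := abs_le.1 (hC θ).2
    have h2 := abs_le.1 (hD θ).2
    have h3 := abs_le.1 hi
    have e : (2 : ℝ) / J = 2 * (1 / J) := by ring
    rw [e]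
    set r : ℝ := ((i : ℕ) / J : ℝ)
    set s : ℝ := 1 / (J : ℝ)
    -- an offset above `2` makes the second argument irrelevant, so it may be cut down to `2`
    have key : c + Min.min (f θ) (Min.min (d - c) 2 + g θ) = Min.min (c + f θ) (d + g θ) := by
      rcases le_total (d - c) 2 with h | h
      · rw [min_eq_left h, ← min_add_add_left]
        congr 1
        ring
      · rw [min_eq_right h, min_eq_left (by linarith [hfθ.2, hgθ.1]),
          min_eq_left (by linarith [hfθ.2, hgθ.1])]
    have h4 : |Min.min (C θ).toReal (D θ).toReal - Min.min (c + f θ) (d + g θ)| ≤ ε :=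
      (abs_min_sub_min_le_max _ _ _ _).trans (max_le (hC θ).2 (hD θ).2)
    have h5 : |Min.min (f θ) (Min.min (d - c) 2 + g θ) - Min.min (f θ) (2 * r + g θ)| ≤ 2 * s := by
      refine (abs_min_sub_min_le_max _ _ _ _).trans (max_le ?_ ?_)
      · simp only [sub_self, abs_zero]
        positivity
      · rw [abs_le]
        constructor <;> linarith
    have h6 := abs_le.1 h4
    have h7 := abs_le.1 h5
    rw [abs_le]
    constructor <;> linarith

lemma IsNear.mix {F : Finset (Θ → ℝ)} (hF : ∀ f ∈ F, ∀ θ, f θ ∈ Set.Icc (0 : ℝ) 2) {J : ℕ}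
    (hJ : 0 < J) {m : ℕ} {ε : ℝ} {C D : Θ → ℝ≥0∞} (hC : IsNear (treeNet F J m) ε C)
    (hD : IsNear (treeNet F J m) ε D) {a b : ℝ≥0∞} (hab : a + b = 1) :
    IsNear (treeNet F J (m + 1)) (ε + 2 / J) fun θ => a * C θ + b * D θ := by
  have hJ' : (0 : ℝ) ≤ 2 / J := by positivity
  have ha1 : a ≠ ∞ := ne_top_of_le_ne_top ENNReal.one_ne_top (hab ▸ le_self_add)
  have hb1 : b ≠ ∞ := ne_top_of_le_ne_top ENNReal.one_ne_top (hab ▸ le_add_self)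
  by_cases ha : a = 0
  · have hb : b = 1 := by simpa [ha] using hab
    simpa [ha, hb] using hD.mono (treeNet_subset_succ F J m) (by linarith)
  by_cases hb : b = 0
  · have ha : a = 1 := by simpa [hb] using hab
    simpa [ha, hb] using hC.mono (treeNet_subset_succ F J m) (by linarith)
  rcases hC with hC | ⟨c, f, hf, hC⟩
  · exact .inl fun θ => by simp [hC θ, ENNReal.mul_top ha]
  rcases hD with hD | ⟨d, g, hg, hD⟩
  · exact .inl fun θ => by simp [hD θ, ENNReal.mul_top hb]
  have habr : a.toReal + b.toReal = 1 := by
    rw [← ENNReal.toReal_add ha1 hb1, hab, ENNReal.toReal_one]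
  obtain ⟨i, hi⟩ := exists_grid_near hJ (x := a.toReal) ENNReal.toReal_nonneg
    (by linarith [ENNReal.toReal_nonneg (a := b)])
  refine .inr ⟨a.toReal * c + b.toReal * d, _, mix_mem_treeNet hf hg i, fun θ => ⟨?_, ?_⟩⟩
  · exact ENNReal.add_ne_top.2 ⟨ENNReal.mul_ne_top ha1 (hC θ).1, ENNReal.mul_ne_top hb1 (hD θ).1⟩
  · rw [ENNReal.toReal_add (ENNReal.mul_ne_top ha1 (hC θ).1) (ENNReal.mul_ne_top hb1 (hD θ).1),
      ENNReal.toReal_mul, ENNReal.toReal_mul]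
    have hfθ := treeNet_mem_Icc hF m f hf θ
    have hgθ := treeNet_mem_Icc hF m g hg θ
    have e : (2 : ℝ) / J = 1 / J * 2 := by ring
    rw [e]
    set r : ℝ := ((i : ℕ) / J : ℝ)
    set s : ℝ := 1 / (J : ℝ)
    have hb' : b.toReal = 1 - a.toReal := by linarith
    have h1 : |a.toReal * ((C θ).toReal - (c + f θ)) + b.toReal * ((D θ).toReal - (d + g θ))| ≤
        a.toReal * ε + b.toReal * ε := by
      refine (abs_add_le _ _).trans (add_le_add ?_ ?_)
      · rw [abs_mul, abs_of_nonneg ENNReal.toReal_nonneg]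
        exact mul_le_mul_of_nonneg_left (hC θ).2 ENNReal.toReal_nonneg
      · rw [abs_mul, abs_of_nonneg ENNReal.toReal_nonneg]
        exact mul_le_mul_of_nonneg_left (hD θ).2 ENNReal.toReal_nonneg
    have h2 : |(a.toReal - r) * (f θ - g θ)| ≤ s * 2 := by
      rw [abs_mul]
      refine mul_le_mul hi ?_ (abs_nonneg _) (by positivity)
      rw [abs_le]
      constructor <;> linarith [hfθ.1, hfθ.2, hgθ.1, hgθ.2]
    have h3 : a.toReal * ε + b.toReal * ε = ε := by rw [← add_mul, habr, one_mul]
    rw [h3] at h1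
    refine le_trans (le_of_eq ?_) ((abs_add_le _ _).trans (add_le_add h1 h2))
    congr 1
    rw [hb']
    ring

namespace AuctionProtocol

variable {n : ℕ}

/-- The part of the cost that is due to the allocation of the bundle `Y`. -/
noncomputable def lossFn (A : Θ → Finset (Fin n)) (y : Θ → ℝ≥0) (Y : Finset (Fin n)) (θ : Θ) : ℝ :=
  (y θ * miss (A θ) Y).toReal

/-- The allocation losses of all bundles. -/
noncomputable def lossFns (A : Θ → Finset (Fin n)) (y : Θ → ℝ≥0) : Finset (Θ → ℝ) :=
  Finset.univ.image (lossFn A y)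

lemma card_lossFns_le (A : Θ → Finset (Fin n)) (y : Θ → ℝ≥0) : (lossFns A y).card ≤ 2 ^ n := by
  refine Finset.card_image_le.trans ?_
  simp

lemma miss_ne_top (A Y : Finset (Fin n)) : miss A Y ≠ ∞ :=
  ne_top_of_le_ne_top ENNReal.one_ne_top (miss_le_one A Y)

lemma lossFns_mem_Icc {A : Θ → Finset (Fin n)} {y : Θ → ℝ≥0} (hy : ∀ θ, y θ ≤ 2) :
    ∀ f ∈ lossFns A y, ∀ θ, f θ ∈ Set.Icc (0 : ℝ) 2 := by
  intro f hf θ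
  obtain ⟨Y, -, rfl⟩ := Finset.mem_image.1 hf
  refine ⟨ENNReal.toReal_nonneg, ?_⟩
  rw [lossFn, ENNReal.toReal_mul]
  have h1 : (miss (A θ) Y).toReal ≤ 1 := by
    simpa using ENNReal.toReal_mono ENNReal.one_ne_top (miss_le_one (A θ) Y)
  have h2 : ((y θ : ℝ≥0∞)).toReal ≤ 2 := by exact_mod_cast hy θ
  nlinarith [ENNReal.toReal_nonneg (a := miss (A θ) Y), ENNReal.toReal_nonneg (a := (y θ : ℝ≥0∞))]

lemma isNear_const_add_loss (A : Θ → Finset (Fin n)) (y : Θ → ℝ≥0) (J m : ℕ) (Y : Finset (Fin n))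
    (q : ℝ≥0∞) :
    IsNear (treeNet (lossFns A y) J m) (m * (2 / J)) fun θ => q + y θ * miss (A θ) Y := by
  have hsub : lossFns A y ⊆ treeNet (lossFns A y) J m := by
    induction m with
    | zero => exact subset_rfl
    | succ m ih => exact ih.trans (treeNet_subset_succ _ _ _)
  by_cases hq : q = ∞
  · exact .inl fun θ => by simp [hq]
  · refine .inr ⟨q.toReal, lossFn A y Y,
      hsub (Finset.mem_image_of_mem _ (Finset.mem_univ _)), fun θ => ?_⟩
    have h1 : (y θ : ℝ≥0∞) * miss (A θ) Y ≠ ∞ :=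
      ENNReal.mul_ne_top ENNReal.coe_ne_top (miss_ne_top _ _)
    refine ⟨ENNReal.add_ne_top.2 ⟨hq, h1⟩, ?_⟩
    rw [ENNReal.toReal_add hq h1, lossFn, sub_self, abs_zero]
    positivity

/-- The truncated cost of a protocol is one of few functions of the buyer's type, up to a small
error and an additive constant, whatever the protocol. -/
lemma isNear_truncCost {A : Θ → Finset (Fin n)} {y : Θ → ℝ≥0} (hy : ∀ θ, y θ ≤ 2) {J : ℕ}
    (hJ : 0 < J) (m : ℕ) (P : AuctionProtocol n) :
    IsNear (treeNet (lossFns A y) J m) (m * (2 / J)) fun θ => truncCost (A θ) (y θ) m P := by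
  induction m generalizing P with
  | zero =>
    by_cases hP : ∃ Y q, P.node [] = .leaf Y q
    · obtain ⟨Y, q, hP⟩ := hP
      simp only [truncCost_of_leaf hP]
      exact isNear_const_add_loss A y J 0 Y q
    · push Not at hP
      simpa [truncCost_zero hP, miss] using
        isNear_const_add_loss A y J 0 ∅ (⨅ σ, P.expPayment σ)
  | succ m ih =>
    have e : ((m + 1 : ℕ) : ℝ) * (2 / J) = m * (2 / J) + 2 / J := by push_cast; ring
    cases hn : P.node [] with
    | leaf Y q =>
      simp only [truncCost_of_leaf hn]
      exact isNear_const_add_loss A y J (m + 1) Y q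
    | buyer =>
      simp only [truncCost, hn, e]
      simpa only [iInf_bool_eq] using
        IsNear.min (lossFns_mem_Icc hy) hJ (ih (P.sub true)) (ih (P.sub false))
    | chance p =>
      simp only [truncCost, hn, e, Fintype.sum_bool]
      exact IsNear.mix (lossFns_mem_Icc hy) hJ (ih (P.sub true)) (ih (P.sub false))
        (by simpa [tsum_fintype] using p.tsum_coe)

end AuctionProtocol

end Net

/-! ### Simultaneous concentration -/

/-- Exponential moment of a bounded random variable of mean zero, from `exp x ≤ 1 + x + x ^ 2`. -/
lemma sum_mul_exp_le {L : Type*} [Fintype L] {w : L → ℝ} (hw0 : ∀ l, 0 ≤ w l)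
    (hw1 : ∑ l, w l = 1) {x : L → ℝ} {s : ℝ} (hs : s ≤ 1) (hx : ∀ l, |x l| ≤ s)
    (hmean : ∑ l, w l * x l = 0) : ∑ l, w l * Real.exp (x l) ≤ Real.exp (s ^ 2) := by
  calc ∑ l, w l * Real.exp (x l) ≤ ∑ l, (w l + w l * x l + w l * s ^ 2) := by
        refine Finset.sum_le_sum fun l _ => ?_
        have h1 := (abs_le.1 (Real.abs_exp_sub_one_sub_id_le ((hx l).trans hs))).2
        have h2 : x l ^ 2 ≤ s ^ 2 := sq_le_sq' (abs_le.1 (hx l)).1 (abs_le.1 (hx l)).2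
        rw [← mul_one_add, ← mul_add]
        exact mul_le_mul_of_nonneg_left (by linarith) (hw0 l)
    _ = s ^ 2 + 1 := by
        rw [Finset.sum_add_distrib, Finset.sum_add_distrib, hw1, hmean, ← Finset.sum_mul, hw1]
        ring
    _ ≤ Real.exp (s ^ 2) := Real.add_one_le_exp _

/-- If there are not too many functions `g`, some point `ℓ` of the product space makes all the sums
`∑ k, g k (ℓ k)` at most slightly larger than their means: otherwise the total of the exponential
moments of these sums, which factorize over `k`, would be too large. -/
lemma exists_forall_sum_sub_mean_lt {ι L : Type*} [Fintype ι] [Fintype L] {w : L → ℝ}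
    (hw0 : ∀ l, 0 ≤ w l) (hw1 : ∑ l, w l = 1) (G : Finset (ι → L → ℝ)) {M t : ℝ} (hM : 0 < M)
    (ht : 0 < t) (htM : t ≤ 4 * M) (hG : ∀ g ∈ G, ∀ k l, |g k l| ≤ M)
    (hcard : (G.card : ℝ) < Real.exp (Fintype.card ι * (t ^ 2 / (16 * M ^ 2)))) :
    ∃ ℓ : ι → L, ∀ g ∈ G, ∑ k, (g k (ℓ k) - ∑ l, w l * g k l) < Fintype.card ι * t := by
  classical
  by_contra! H
  set N : ℝ := (Fintype.card ι : ℝ)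
  -- the minimizer of `lam ^ 2 * (2 * M) ^ 2 - lam * t`; the centred terms are at most `2 * M`
  set lam : ℝ := t / (8 * M ^ 2)
  have hlam : 0 < lam := by positivity
  let W : (ι → L) → ℝ := fun ℓ => ∏ k, w (ℓ k)
  have hW0 : ∀ ℓ, 0 ≤ W ℓ := fun ℓ => Finset.prod_nonneg fun k _ => hw0 _
  have hW1 : ∑ ℓ, W ℓ = 1 := by
    rw [← Fintype.piFinset_univ, ← Finset.prod_univ_sum (fun _ => Finset.univ) fun _ l => w l]
    simp [hw1]
  let d : (ι → L → ℝ) → ι → L → ℝ := fun g k l => lam * (g k l - ∑ l, w l * g k l)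
  have hlow : Real.exp (lam * (N * t)) ≤ ∑ ℓ, W ℓ * ∑ g ∈ G, Real.exp (∑ k, d g k (ℓ k)) := by
    calc Real.exp (lam * (N * t)) = ∑ ℓ, W ℓ * Real.exp (lam * (N * t)) := by
          rw [← Finset.sum_mul, hW1, one_mul]
      _ ≤ _ := by
          refine Finset.sum_le_sum fun ℓ _ => mul_le_mul_of_nonneg_left ?_ (hW0 ℓ)
          obtain ⟨g, hg, hgℓ⟩ := H ℓ
          refine le_trans ?_ (Finset.single_le_sum
            (f := fun g => Real.exp (∑ k, d g k (ℓ k))) (fun _ _ => (Real.exp_pos _).le) hg)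
          simp only [d, ← Finset.mul_sum]
          gcongr
  have hup : ∀ g ∈ G, ∑ ℓ, W ℓ * Real.exp (∑ k, d g k (ℓ k)) ≤
      Real.exp (N * (lam * (2 * M)) ^ 2) := by
    intro g hg
    have e : ∀ ℓ : ι → L, W ℓ * Real.exp (∑ k, d g k (ℓ k)) =
        ∏ k, (w (ℓ k) * Real.exp (d g k (ℓ k))) := by
      intro ℓ
      rw [Real.exp_sum, Finset.prod_mul_distrib]
    simp only [e]
    rw [← Fintype.piFinset_univ,
      ← Finset.prod_univ_sum (fun _ => Finset.univ) fun k l => w l * Real.exp (d g k l)]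
    have hk : ∀ k, ∑ l, w l * Real.exp (d g k l) ≤ Real.exp ((lam * (2 * M)) ^ 2) := by
      intro k
      refine sum_mul_exp_le hw0 hw1 ?_ (fun l => ?_) ?_
      · simp only [lam]
        rw [div_mul_eq_mul_div, div_le_one (by positivity)]
        nlinarith
      · rw [abs_mul, abs_of_pos hlam]
        refine mul_le_mul_of_nonneg_left ?_ hlam.le
        have h1 : |∑ l, w l * g k l| ≤ M := by
          calc |∑ l, w l * g k l| ≤ ∑ l, |w l * g k l| := Finset.abs_sum_le_sum_abs _ _
            _ ≤ ∑ l, w l * M := by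
                refine Finset.sum_le_sum fun l _ => ?_
                rw [abs_mul, abs_of_nonneg (hw0 l)]
                exact mul_le_mul_of_nonneg_left (hG g hg k l) (hw0 l)
            _ = M := by rw [← Finset.sum_mul, hw1, one_mul]
        have h2 := abs_le.1 (hG g hg k l)
        have h3 := abs_le.1 h1
        rw [abs_le]
        constructor <;> linarith
      · have : ∀ l, w l * d g k l = lam * (w l * g k l - w l * ∑ l, w l * g k l) := by
          intro l
          simp only [d]
          ring
        simp only [this]
        rw [← Finset.mul_sum, Finset.sum_sub_distrib, ← Finset.sum_mul, hw1, one_mul, sub_self,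
          mul_zero]
    calc ∏ k, ∑ l, w l * Real.exp (d g k l) ≤ ∏ _k : ι, Real.exp ((lam * (2 * M)) ^ 2) :=
          Finset.prod_le_prod (fun k _ => Finset.sum_nonneg fun l _ =>
            mul_nonneg (hw0 l) (Real.exp_pos _).le) fun k _ => hk k
      _ = _ := by
          rw [Finset.prod_const, ← Real.exp_nat_mul]
          rfl
  have hsum : Real.exp (lam * (N * t)) ≤ G.card * Real.exp (N * (lam * (2 * M)) ^ 2) := by
    refine hlow.trans ?_
    simp only [Finset.mul_sum]
    rw [Finset.sum_comm]
    refine (Finset.sum_le_sum hup).trans ?_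
    simp
  have hlt : G.card * Real.exp (N * (lam * (2 * M)) ^ 2) < Real.exp (lam * (N * t)) := by
    calc _ < Real.exp (N * (t ^ 2 / (16 * M ^ 2))) * Real.exp (N * (lam * (2 * M)) ^ 2) :=
          mul_lt_mul_of_pos_right hcard (Real.exp_pos _)
      _ = _ := by
          rw [← Real.exp_add]
          congr 1
          simp only [lam]
          field_simp
          ring
  exact absurd hsum (not_le.2 hlt)

/-! ### A binary code -/

/-- A binary code of positive rate and positive relative distance. A maximal code of this distance
is large, because the balls around its words cover the cube (the Gilbert–Varshamov bound). -/
lemma exists_code (q : ℕ) : ∃ C : Finset (Fin (16 * q) → Bool), 16 ^ q ≤ C.card ∧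
    ∀ a ∈ C, ∀ b ∈ C, a ≠ b → 2 * q < hammingDist a b := by
  classical
  let S : Finset (Finset (Fin (16 * q) → Bool)) :=
    Finset.univ.filter fun C => ∀ a ∈ C, ∀ b ∈ C, a ≠ b → 2 * q < hammingDist a b
  obtain ⟨C, hC⟩ := S.exists_maximal ⟨∅, by simp [S]⟩
  have hCS : ∀ a ∈ C, ∀ b ∈ C, a ≠ b → 2 * q < hammingDist a b := by
    simpa [S] using hC.prop
  refine ⟨C, ?_, hCS⟩
  have hcover : ∀ x, ∃ c ∈ C, hammingDist x c ≤ 2 * q := by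
    intro x
    by_contra! H
    have hins : insert x C ∈ S := by
      simp only [S, Finset.mem_filter, Finset.mem_univ, true_and, Finset.mem_insert]
      rintro a (rfl | ha) b (rfl | hb) hab
      · exact absurd rfl hab
      · exact H b hb
      · rw [hammingDist_comm]
        exact H a ha
      · exact hCS a ha b hb hab
    have hx : x ∈ C := hC.le_of_ge hins (Finset.subset_insert x C) (Finset.mem_insert_self x C)
    have := H x hx
    simp at this
  -- balls are counted with the weights `2 ^ (2 * q - distance)`, which are at least `1` on a ball
  have hweight : ∀ c : Fin (16 * q) → Bool, ∑ x, (1 / 2 : ℝ) ^ hammingDist x c =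
      (3 / 2 : ℝ) ^ (16 * q) := by
    intro c
    have e : ∀ x : Fin (16 * q) → Bool, (1 / 2 : ℝ) ^ hammingDist x c =
        ∏ i, if x i ≠ c i then (1 / 2 : ℝ) else 1 := by
      intro x
      rw [Finset.prod_ite, Finset.prod_const, Finset.prod_const_one, mul_one]
      rfl
    simp only [e]
    rw [← Fintype.piFinset_univ, ← Finset.prod_univ_sum (fun _ => Finset.univ)
      fun i b => if b ≠ c i then (1 / 2 : ℝ) else 1]
    have : ∀ i, (∑ b, if b ≠ c i then (1 / 2 : ℝ) else 1) = 3 / 2 := by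
      intro i
      cases c i <;> norm_num
    simp only [this, Finset.prod_const, Finset.card_univ, Fintype.card_fin]
  have hcount : (2 : ℝ) ^ (16 * q) ≤ C.card * ((2 : ℝ) ^ (2 * q) * (3 / 2 : ℝ) ^ (16 * q)) := by
    calc (2 : ℝ) ^ (16 * q) = ∑ _x : Fin (16 * q) → Bool, (1 : ℝ) := by simp
      _ ≤ ∑ x : Fin (16 * q) → Bool, ∑ c ∈ C, (2 : ℝ) ^ (2 * q) * (1 / 2) ^ hammingDist x c := by
          refine Finset.sum_le_sum fun x _ => ?_
          obtain ⟨c, hc, hxc⟩ := hcover x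
          refine le_trans ?_ (Finset.single_le_sum
            (f := fun c => (2 : ℝ) ^ (2 * q) * (1 / 2) ^ hammingDist x c)
            (fun _ _ => by positivity) hc)
          rw [one_div, inv_pow, ← div_eq_mul_inv, one_le_div (by positivity)]
          exact pow_le_pow_right₀ (by norm_num) hxc
      _ = _ := by
          rw [Finset.sum_comm]
          simp only [← Finset.mul_sum, hweight]
          rw [Finset.sum_const, nsmul_eq_mul]
          ring
  have hnum : (16 : ℝ) ^ q * ((2 : ℝ) ^ (2 * q) * (3 / 2 : ℝ) ^ (16 * q)) ≤ 2 ^ (16 * q) := by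
    rw [pow_mul, pow_mul, pow_mul, ← mul_pow, ← mul_pow]
    exact pow_le_pow_left₀ (by positivity) (by norm_num) q
  have hfin : (16 : ℝ) ^ q ≤ C.card :=
    le_of_mul_le_mul_right (hnum.trans hcount) (by positivity)
  exact_mod_cast hfin

/-- The set of items that encodes a binary word `a`: of each pair of items, one is chosen
according to the letter of `a`. -/
def wordSet {m n : ℕ} (e : Fin m × Bool ↪ Fin n) (a : Fin m → Bool) : Finset (Fin n) :=
  Finset.univ.image fun i => e (i, a i)

lemma card_wordSet {m n : ℕ} (e : Fin m × Bool ↪ Fin n) (a : Fin m → Bool) :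
    (wordSet e a).card = m := by
  rw [wordSet, Finset.card_image_of_injective]
  · simp
  · intro i j h
    exact (Prod.ext_iff.1 (e.injective h)).1

lemma card_wordSet_inter_add_hammingDist_le {m n : ℕ} (e : Fin m × Bool ↪ Fin n)
    (a b : Fin m → Bool) : (wordSet e a ∩ wordSet e b).card + hammingDist a b ≤ m := by
  have h1 : wordSet e a ∩ wordSet e b ⊆
      (Finset.univ.filter fun i => ¬a i ≠ b i).image fun i => e (i, a i) := by
    intro y hy
    rw [Finset.mem_inter, wordSet, wordSet, Finset.mem_image, Finset.mem_image] at hy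
    obtain ⟨⟨i, -, rfl⟩, ⟨j, -, hj⟩⟩ := hy
    obtain ⟨rfl, h⟩ := Prod.ext_iff.1 (e.injective hj)
    exact Finset.mem_image.2 ⟨j, by simpa using h.symm, rfl⟩
  have h2 := (Finset.card_le_card h1).trans Finset.card_image_le
  have h3 := Finset.card_filter_add_card_filter_not (s := (Finset.univ : Finset (Fin m)))
    (fun i => a i ≠ b i)
  rw [Finset.card_univ, Fintype.card_fin] at h3
  have h4 : hammingDist a b = (Finset.univ.filter fun i => a i ≠ b i).card := rfl
  omega

/-! ### The prior and its optimal revenue -/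

section Prior

variable {n : ℕ}

/-- The valuation of a buyer who values every bundle that meets `A` at `y`. -/
noncomputable def hitVal (A : Finset (Fin n)) (y : ℝ≥0) : BundleValuation n :=
  fun S => if Disjoint S A then 0 else y

lemma isUnitDemand_hitVal (A : Finset (Fin n)) (y : ℝ≥0) : IsUnitDemand (hitVal A y) := by
  refine ⟨fun i => if i ∈ A then y else 0, fun S => ?_⟩
  unfold hitVal
  split_ifs with h
  · symm
    rw [← bot_eq_zero, Finset.sup_eq_bot_iff]
    intro i hi
    simp [Finset.disjoint_left.1 h hi]
  · obtain ⟨i, hi, hiA⟩ := Finset.not_disjoint_iff.1 h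
    refine le_antisymm ?_ (Finset.sup_le fun j _ => by split <;> simp)
    refine le_trans ?_ (Finset.le_sup hi)
    simp [hiA]

lemma hitVal_le (A : Finset (Fin n)) (y : ℝ≥0) (S : Finset (Fin n)) : hitVal A y S ≤ y := by
  unfold hitVal
  split <;> simp

lemma hitVal_singleton (A : Finset (Fin n)) (y : ℝ≥0) (i : Fin n) :
    hitVal A y {i} = if i ∈ A then y else 0 := by
  by_cases h : i ∈ A <;> simp [hitVal, h]

lemma hitVal_univ {A : Finset (Fin n)} (hA : A.Nonempty) (y : ℝ≥0) :
    hitVal A y Finset.univ = y := by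
  have : ¬Disjoint Finset.univ A := by
    obtain ⟨i, hi⟩ := hA
    exact Finset.not_disjoint_iff.2 ⟨i, Finset.mem_univ i, hi⟩
  simp [hitVal, this]

lemma tsum_map_mul {α β : Type*} (p : PMF α) (f : α → β) (F : β → ℝ≥0∞) :
    ∑' b, p.map f b * F b = ∑' a, p a * F (f a) := by
  classical
  simp only [PMF.map_apply, ← ENNReal.tsum_mul_right]
  rw [ENNReal.tsum_comm]
  refine tsum_congr fun a => ?_
  rw [tsum_eq_single (f a)]
  · simp
  · intro b hb
    simp [hb]

/-- Distribution of the type of a uniformly random `k`, who wants one item of `A k` and values it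
at `x k`. -/
noncomputable def hitPrior {ι : Type*} [Fintype ι] [Nonempty ι] (A : ι → Finset (Fin n))
    (x : ι → ℝ≥0) : PMF (BundleValuation n) :=
  (PMF.uniformOfFintype ι).map fun k => hitVal (A k) (x k)

variable {ι : Type*} [Fintype ι] [Nonempty ι] (A : ι → Finset (Fin n)) (x : ι → ℝ≥0)

lemma mem_support_hitPrior {v : BundleValuation n} :
    v ∈ (hitPrior A x).support ↔ ∃ k, hitVal (A k) (x k) = v := by
  rw [hitPrior, PMF.mem_support_map_iff]
  simp

lemma finite_support_hitPrior : (hitPrior A x).support.Finite := by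
  have : (hitPrior A x).support = Set.range fun k => hitVal (A k) (x k) := by
    ext v
    exact mem_support_hitPrior A x
  rw [this]
  exact Set.finite_range _

lemma tsum_hitPrior_mul (F : BundleValuation n → ℝ≥0∞) :
    ∑' v, hitPrior A x v * F v =
      (Fintype.card ι : ℝ≥0∞)⁻¹ * ∑ k, F (hitVal (A k) (x k)) := by
  rw [hitPrior, tsum_map_mul, tsum_fintype, Finset.mul_sum]
  simp

namespace DirectMechanism

/-- The items that a valuation does not value at zero. -/
noncomputable def wanted (r : BundleValuation n) : Finset (Fin n) :=
  Finset.univ.filter fun i => r {i} ≠ 0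

/-- The mechanism that allocates a uniformly random wanted item, for an eighth of the value of all
items. -/
noncomputable def wantedLottery (n : ℕ) : DirectMechanism n where
  alloc r := if h : (wanted r).Nonempty then (PMF.uniformOfFinset (wanted r) h).map singleton
    else PMF.pure ∅
  pay r := r Finset.univ / 8

lemma wanted_hitVal (A : Finset (Fin n)) {y : ℝ≥0} (hy : y ≠ 0) : wanted (hitVal A y) = A := by
  ext i
  simp [wanted, hitVal_singleton, hy]

lemma expValue_wantedLottery (A : Finset (Fin n)) (y : ℝ≥0) {B : Finset (Fin n)}
    (hB : B.Nonempty) {z : ℝ≥0} (hz : z ≠ 0) :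
    (wantedLottery n).expValue (hitVal A y) (hitVal B z) =
      ((y * (B ∩ A).card / B.card : ℝ≥0) : ℝ≥0∞) := by
  have hB0 : (B.card : ℝ≥0) ≠ 0 := by
    simpa using hB.ne_empty
  rw [expValue, ← tsum_fintype (L := .unconditional _)]
  have hw : (wanted (hitVal B z)).Nonempty := by rwa [wanted_hitVal B hz]
  simp only [wantedLottery, dif_pos hw]
  rw [tsum_map_mul _ _ fun S => ((hitVal A y S : ℝ≥0) : ℝ≥0∞), tsum_fintype]
  have : ∀ i, PMF.uniformOfFinset (wanted (hitVal B z)) hw i * ((hitVal A y {i} : ℝ≥0) : ℝ≥0∞) =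
      if i ∈ B ∩ A then (B.card : ℝ≥0∞)⁻¹ * y else 0 := by
    intro i
    by_cases h1 : i ∈ B <;> by_cases h2 : i ∈ A <;>
      simp [hitVal_singleton, wanted_hitVal B hz, h1, h2]
  simp only [this]
  rw [Finset.sum_ite_mem, Finset.univ_inter, Finset.sum_const, nsmul_eq_mul, ENNReal.coe_div hB0,
    div_eq_mul_inv]
  push_cast
  ring

end DirectMechanism

/-- If the sets `A k` are of equal size and any two of them have at most seven eighths of their
items in common, an eighth of the expected value of the wanted item can be charged: type `k` gains
at least `x k / 8` in value by receiving an item of `A k` rather than one of another `A j`. -/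
lemma le_optimalRevenue_hitPrior {A : ι → Finset (Fin n)} {x : ι → ℝ≥0} (hx : ∀ k, x k ≠ 0)
    {m : ℕ} (hm : 0 < m) (hA : ∀ k, (A k).card = m)
    (hAA : ∀ j k, j ≠ k → 8 * (A j ∩ A k).card ≤ 7 * m) :
    (Fintype.card ι : ℝ≥0∞)⁻¹ * ∑ k, ((x k / 8 : ℝ≥0) : ℝ≥0∞) ≤
      optimalRevenue (hitPrior A x) := by
  have hne : ∀ k, (A k).Nonempty := fun k => Finset.card_pos.1 (by rw [hA]; exact hm)
  have hm' : (0 : ℝ≥0) < m := by exact_mod_cast hm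
  have hself : ∀ k, (DirectMechanism.wantedLottery n).expValue (hitVal (A k) (x k))
      (hitVal (A k) (x k)) = x k := by
    intro k
    rw [DirectMechanism.expValue_wantedLottery _ _ (hne k) (hx k), Finset.inter_self, hA,
      mul_div_cancel_right₀ _ hm'.ne']
  have hIC : (DirectMechanism.wantedLottery n).IsIC (hitPrior A x) := by
    intro v hv r hr
    obtain ⟨k, rfl⟩ := (mem_support_hitPrior A x).1 hv
    obtain ⟨j, rfl⟩ := (mem_support_hitPrior A x).1 hr
    by_cases hjk : j = k
    · rw [hjk]
    · refine le_trans ?_ le_self_add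
      rw [hself, DirectMechanism.expValue_wantedLottery _ _ (hne j) (hx j), hA]
      simp only [DirectMechanism.wantedLottery, hitVal_univ (hne k)]
      have h1 : ((A j ∩ A k).card : ℝ≥0) ≤ 7 / 8 * m := by
        have : (8 * (A j ∩ A k).card : ℝ≥0) ≤ 7 * m := by exact_mod_cast hAA j k hjk
        rw [div_mul_eq_mul_div, le_div_iff₀ (by norm_num)]
        linarith
      have h2 : x k * ((A j ∩ A k).card : ℝ≥0) / m ≤ x k * (7 / 8) := by
        rw [div_le_iff₀ hm', mul_assoc]
        gcongr
      have h3 : x k * ((A j ∩ A k).card : ℝ≥0) / m + x k / 8 ≤ x k := by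
        refine (add_le_add_left h2 _).trans (le_of_eq ?_)
        rw [div_eq_mul_one_div (x k) 8, ← mul_add]
        norm_num
      exact_mod_cast h3
  have hIR : (DirectMechanism.wantedLottery n).IsIR (hitPrior A x) := by
    intro v hv
    obtain ⟨k, rfl⟩ := (mem_support_hitPrior A x).1 hv
    rw [hself]
    simp only [DirectMechanism.wantedLottery, hitVal_univ (hne k)]
    exact_mod_cast div_le_self zero_le (by norm_num : (1 : ℝ≥0) ≤ 8)
  refine le_trans (le_of_eq ?_) (le_iSup₂ (f := fun (M : DirectMechanism n)
    (_ : M.IsIC (hitPrior A x) ∧ M.IsIR (hitPrior A x)) => M.revenue (hitPrior A x))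
    (DirectMechanism.wantedLottery n) ⟨hIC, hIR⟩)
  rw [DirectMechanism.revenue, tsum_hitPrior_mul]
  simp only [DirectMechanism.wantedLottery, hitVal_univ (hne _)]

end Prior

/-! ### Payments and costs under almost truthfulness -/

namespace AuctionProtocol

variable {n : ℕ}

lemma runProb_le_one (m : ℕ) (P : AuctionProtocol n) (σ : BuyerStrategy) : runProb m P σ ≤ 1 :=
  le_add_self.trans_eq (leafExp_length_le_add_runProb m P σ)

lemma expValue_hitVal_add {P : AuctionProtocol n} (hP : P.IsFinite) (A : Finset (Fin n))
    (y : ℝ≥0) (σ : BuyerStrategy) :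
    P.expValue (hitVal A y) σ + y * P.leafExp σ (fun _ Y _ => miss A Y) = y := by
  rw [expValue, ← leafExp_const_mul, ← leafExp_add]
  have : ∀ Y : Finset (Fin n), ((hitVal A y Y : ℝ≥0) : ℝ≥0∞) + y * miss A Y = y * 1 := by
    intro Y
    by_cases h : Disjoint Y A <;> simp [hitVal, miss, h]
  simp only [this]
  rw [leafExp_const_mul, hP σ, mul_one]

/-- By individual rationality, the utility is non-negative even in the truncated protocol, up to
the value lost in the truncation. -/
lemma truncCost_le_two_mul {P : AuctionProtocol n} (hP : P.IsIR) (A : Finset (Fin n)) (y : ℝ≥0)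
    (m : ℕ) : truncCost A y m P ≤ 2 * y := by
  obtain ⟨σ, hσ, -⟩ := hP
  refine (truncCost_le A y m P σ).trans ?_
  rw [two_mul]
  refine add_le_add ?_ ?_
  · simpa [hσ] using P.cost_le A y σ
  · calc (y : ℝ≥0∞) * runProb m P σ ≤ y * 1 := by
          gcongr
          exact runProb_le_one m P σ
      _ = y := mul_one _

lemma cost_suggested_le {P : AuctionProtocol n} {D : PMF (BundleValuation n)} {δ : ℝ≥0}
    (hP : P.IsAlmostIC D δ) {A : Finset (Fin n)} {x : ℝ≥0} (hx : hitVal A x ∈ D.support)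
    (m : ℕ) : P.cost A x (P.suggested (hitVal A x)) ≤ truncCost A x m P + δ := by
  refine le_trans ?_ (add_le_add_left (iInf_cost_le_truncCost A x m P) _)
  rw [ENNReal.iInf_add]
  refine le_iInf fun σ => ?_
  have h := hP.2.2 _ hx σ
  have h1 := expValue_hitVal_add hP.1 A x σ
  have h2 := expValue_hitVal_add hP.1 A x (P.suggested (hitVal A x))
  rw [cost_eq, cost_eq]
  refine (ENNReal.add_le_add_iff_left (a := x) ENNReal.coe_ne_top).1 ?_
  set s := P.suggested (hitVal A x)
  set a := (x : ℝ≥0∞) * P.leafExp σ (fun _ Y _ => miss A Y)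
  set b := (x : ℝ≥0∞) * P.leafExp s (fun _ Y _ => miss A Y)
  calc (x : ℝ≥0∞) + (P.expPayment s + b) =
        (P.expValue (hitVal A x) σ + P.expPayment s) + (a + b) := by
        conv_lhs => rw [← h1]
        ring
    _ ≤ (P.expValue (hitVal A x) s + P.expPayment σ + δ) + (a + b) := by gcongr
    _ = (x : ℝ≥0∞) + (P.expPayment σ + a + δ) := by
        conv_rhs => rw [← h2]
        ring

/-- The payment of a type is governed by the costs at its own value and at twice that value: the
type with the doubled value may imitate it, and then gains the doubled value for the same
payment. -/
lemma expPayment_add_truncCost_le {P : AuctionProtocol n} {D : PMF (BundleValuation n)} {δ : ℝ≥0}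
    (hP : P.IsAlmostIC D δ) {A : Finset (Fin n)} {x : ℝ≥0} (hx : hitVal A x ∈ D.support)
    (m : ℕ) :
    P.expPayment (P.suggested (hitVal A x)) + truncCost A (2 * x) m P ≤
      2 * truncCost A x m P + 2 * δ + 2 * x * runProb m P (P.suggested (hitVal A x)) := by
  have h1 := cost_suggested_le hP hx m
  have h2 := truncCost_le A (2 * x) m P (P.suggested (hitVal A x))
  rw [cost_eq] at h1 h2
  set s := P.suggested (hitVal A x)
  set b := P.leafExp s (fun _ Y _ => miss A Y)
  calc _ ≤ P.expPayment s + (P.expPayment s + ((2 * x : ℝ≥0) : ℝ≥0∞) * b +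
        ((2 * x : ℝ≥0) : ℝ≥0∞) * runProb m P s) := by gcongr
    _ = 2 * (P.expPayment s + x * b) + 2 * x * runProb m P s := by
        push_cast
        ring
    _ ≤ 2 * (truncCost A x m P + δ) + 2 * x * runProb m P s := by gcongr
    _ = _ := by ring

end AuctionProtocol

/-! ### Value levels -/

section Levels

/-- Values decrease by powers of two. Level `l` of the prior has the value `levelVal (l + 1)`;
`levelVal 0 = 2` is there since costs are also considered at the doubled values. -/
noncomputable def levelVal (j : ℕ) : ℝ≥0 := 2 / 2 ^ j

lemma levelVal_le_two (j : ℕ) : levelVal j ≤ 2 :=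
  div_le_self zero_le (one_le_pow₀ one_le_two)

lemma levelVal_ne_zero (j : ℕ) : levelVal j ≠ 0 := by
  unfold levelVal
  positivity

lemma levelVal_succ (j : ℕ) : levelVal (j + 1) = 1 / 2 ^ j := by
  unfold levelVal
  rw [pow_succ']
  field_simp

lemma levelVal_succ_le_one (j : ℕ) : levelVal (j + 1) ≤ 1 := by
  rw [levelVal_succ]
  exact div_le_self zero_le (one_le_pow₀ one_le_two)

lemma two_mul_levelVal_succ (j : ℕ) : 2 * levelVal (j + 1) = levelVal j := by
  rw [levelVal_succ, levelVal, mul_one_div]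

lemma coe_levelVal_succ (j : ℕ) : (levelVal (j + 1) : ℝ) = 1 / 2 ^ j := by
  rw [levelVal_succ]
  push_cast
  rfl

/-- The equal-revenue distribution on the levels `0, …, K`: the value `2⁻ˡ` has a probability
proportional to `2ˡ`. -/
noncomputable def levelWeight (K : ℕ) (l : Fin (K + 1)) : ℝ := 2 ^ (l : ℕ) / (2 ^ (K + 1) - 1)

lemma levelNorm_ge (K : ℕ) : (2 : ℝ) ^ K ≤ 2 ^ (K + 1) - 1 := by
  have : (1 : ℝ) ≤ 2 ^ K := one_le_pow₀ one_le_two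
  rw [pow_succ]
  linarith

lemma levelNorm_pos (K : ℕ) : (0 : ℝ) < 2 ^ (K + 1) - 1 :=
  (by positivity : (0 : ℝ) < 2 ^ K).trans_le (levelNorm_ge K)

lemma levelWeight_nonneg (K : ℕ) (l : Fin (K + 1)) : 0 ≤ levelWeight K l :=
  div_nonneg (by positivity) (levelNorm_pos K).le

/-- The virtual values telescope under the equal-revenue distribution. -/
lemma sum_levelWeight_mul_virtual (K : ℕ) (C : ℕ → ℝ) :
    ∑ l, levelWeight K l * (2 * C (l + 1) - C l) =
      (2 ^ (K + 1) * C (K + 1) - C 0) / (2 ^ (K + 1) - 1) := by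
  have e : ∀ l : Fin (K + 1), levelWeight K l * (2 * C (l + 1) - C l) =
      (2 ^ ((l : ℕ) + 1) * C (l + 1) - 2 ^ (l : ℕ) * C l) / (2 ^ (K + 1) - 1) := by
    intro l
    rw [levelWeight]
    ring
  simp only [e]
  rw [← Finset.sum_div, Fin.sum_univ_eq_sum_range
    (fun l => (2 : ℝ) ^ (l + 1) * C (l + 1) - 2 ^ l * C l), Finset.sum_range_sub
    (fun l => (2 : ℝ) ^ l * C l)]
  simp

lemma sum_levelWeight (K : ℕ) : ∑ l, levelWeight K l = 1 := by
  have := sum_levelWeight_mul_virtual K fun _ => 1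
  rw [mul_one, mul_one, div_self (levelNorm_pos K).ne'] at this
  rw [← this]
  refine Finset.sum_congr rfl fun l _ => ?_
  ring

lemma sum_levelWeight_mul_value (K : ℕ) :
    ((K : ℝ) + 1) / 2 ^ (K + 1) ≤ ∑ l, levelWeight K l * (1 / 2 ^ (l : ℕ)) := by
  have e : ∀ l : Fin (K + 1), levelWeight K l * (1 / 2 ^ (l : ℕ)) =
      1 / (2 ^ (K + 1) - 1) := by
    intro l
    rw [levelWeight]
    field_simp
  simp only [e]
  rw [Finset.sum_const, Finset.card_univ, Fintype.card_fin, nsmul_eq_mul, mul_one_div]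
  push_cast
  exact div_le_div_of_nonneg_left (by positivity) (levelNorm_pos K) (by linarith)

end Levels

/-! ### A pseudorandom assignment of values -/

section Assignment

open AuctionProtocol

variable {n : ℕ} {ι : Type*}

/-- The net for the truncated costs of all protocols at depth `q`, as functions of a set `A k` and
a value level. Its grid is fine enough for a total error of `2⁻ᴷ / 6`. -/
noncomputable def costNet (A : ι → Finset (Fin n)) (q K : ℕ) : Finset (ι × ℕ → ℝ) :=
  treeNet (lossFns (fun θ => A θ.1) fun θ => levelVal θ.2) (12 * q * 2 ^ K) q

lemma costNet_mem_Icc (A : ι → Finset (Fin n)) (q K : ℕ) :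
    ∀ f ∈ costNet A q K, ∀ θ, f θ ∈ Set.Icc (0 : ℝ) 2 :=
  treeNet_mem_Icc (lossFns_mem_Icc fun _ => levelVal_le_two _) q

lemma card_costNet_lt (A : ι → Finset (Fin n)) {q K : ℕ} (hq : 0 < q) (hn : n ≤ 64 * q) :
    (costNet A q K).card + 1 ≤ 2 ^ ((70 + K) * 4 ^ q) := by
  have h1 := card_treeNet_le (lossFns (fun θ : ι × ℕ => A θ.1) fun θ => levelVal θ.2)
    (12 * q * 2 ^ K) q
  have hq2 : q < 2 ^ q := Nat.lt_two_pow_self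
  have h2 : 2 * (12 * q * 2 ^ K + 1) ≤ 2 ^ (5 + q + K) := by
    have h3 : 1 ≤ q * 2 ^ K := Nat.mul_pos hq (by positivity)
    have h4 : q * 2 ^ K ≤ 2 ^ q * 2 ^ K := Nat.mul_le_mul_right _ hq2.le
    calc 2 * (12 * q * 2 ^ K + 1) ≤ 2 ^ 5 * (2 ^ q * 2 ^ K) := by
          have : 12 * q * 2 ^ K = 12 * (q * 2 ^ K) := by ring
          omega
      _ = 2 ^ (5 + q + K) := by ring
  have h5 : 2 * (12 * q * 2 ^ K + 1) *
      (lossFns (fun θ : ι × ℕ => A θ.1) fun θ => levelVal θ.2).card ≤ 2 ^ ((70 + K) * 2 ^ q) := by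
    calc _ ≤ 2 ^ (5 + q + K) * 2 ^ n := Nat.mul_le_mul h2 (card_lossFns_le _ _)
      _ = 2 ^ (5 + q + K + n) := by rw [← pow_add]
      _ ≤ 2 ^ ((70 + K) * 2 ^ q) := by
          refine Nat.pow_le_pow_right two_pos ?_
          nlinarith
  have h6 : (2 ^ ((70 + K) * 2 ^ q)) ^ 2 ^ q = 2 ^ ((70 + K) * 4 ^ q) := by
    rw [← pow_mul, mul_assoc, ← mul_pow]
    norm_num
  have h7 : 2 * (costNet A q K).card ≤ 2 ^ ((70 + K) * 4 ^ q) := by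
    rw [← h6]
    refine le_trans ?_ (Nat.pow_le_pow_left h5 _)
    refine le_trans (Nat.mul_le_mul_right _ ?_) h1
    omega
  have h8 : 0 < 2 ^ ((70 + K) * 4 ^ q) := by positivity
  omega

/-- There is an assignment of values to the sets `A k` that no protocol of depth `q` can tell from
random ones: the virtual values of all members of the net average to at most their means under the
equal-revenue distribution, up to `2⁻ᴷ`; and the assigned values have a large average. -/
lemma exists_levels [Fintype ι] (A : ι → Finset (Fin n)) {q K : ℕ} (hq : 0 < q)
    (hn : n ≤ 64 * q) (hqK : (70 + K) * 256 * 4 ^ K < 4 ^ q) (hι : 16 ^ q ≤ Fintype.card ι) :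
    ∃ ℓ : ι → Fin (K + 1),
      (∀ f ∈ costNet A q K, ∑ k, (2 * f (k, ℓ k + 1) - f (k, ℓ k)) ≤
        Fintype.card ι * (1 / 2 ^ K) +
          ∑ k, ∑ l, levelWeight K l * (2 * f (k, l + 1) - f (k, l))) ∧
      (Fintype.card ι : ℝ) * (((K : ℝ) - 1) / 2 ^ (K + 1)) ≤ ∑ k, 1 / 2 ^ (ℓ k : ℕ) := by
  classical
  let G : Finset (ι → Fin (K + 1) → ℝ) := insert
    (fun (_ : ι) (l : Fin (K + 1)) => -(1 / 2 ^ (l : ℕ) : ℝ))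
    ((costNet A q K).image fun f k l => 2 * f (k, l + 1) - f (k, l))
  have hG : ∀ g ∈ G, ∀ k l, |g k l| ≤ 4 := by
    intro g hg k l
    rcases Finset.mem_insert.1 hg with rfl | hg
    · have h1 : (1 : ℝ) / 2 ^ (l : ℕ) ≤ 1 := div_le_self zero_le_one (one_le_pow₀ one_le_two)
      rw [abs_neg, abs_of_nonneg (by positivity)]
      linarith
    · obtain ⟨f, hf, rfl⟩ := Finset.mem_image.1 hg
      have h1 := costNet_mem_Icc A q K f hf (k, l + 1)
      have h2 := costNet_mem_Icc A q K f hf (k, l)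
      rw [abs_le]
      constructor <;> linarith [h1.1, h1.2, h2.1, h2.2]
  have hcard : (G.card : ℝ) <
      Real.exp (Fintype.card ι * ((1 / 2 ^ K : ℝ) ^ 2 / (16 * 4 ^ 2))) := by
    have h1 : G.card ≤ 2 ^ ((70 + K) * 4 ^ q) :=
      (Finset.card_insert_le _ _).trans
        ((Nat.add_le_add_right Finset.card_image_le 1).trans (card_costNet_lt A hq hn))
    have h2 : (G.card : ℝ) ≤ 2 ^ ((70 + K) * 4 ^ q) := by exact_mod_cast h1
    have h3 : (2 : ℝ) ^ ((70 + K) * 4 ^ q) ≤ Real.exp (((70 + K) * 4 ^ q : ℕ) : ℝ) := by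
      rw [← mul_one (((70 + K) * 4 ^ q : ℕ) : ℝ), Real.exp_nat_mul]
      exact pow_le_pow_left₀ zero_le_two (by linarith [Real.add_one_le_exp 1]) _
    refine (h2.trans h3).trans_lt (Real.exp_lt_exp.2 ?_)
    have h4 : (1 / 2 ^ K : ℝ) ^ 2 / (16 * 4 ^ 2) = 1 / (256 * 4 ^ K) := by
      rw [show (4 : ℝ) ^ K = 2 ^ K * 2 ^ K by rw [← mul_pow]; norm_num]
      field_simp
      norm_num
    have h5 : ((70 + K) * 4 ^ q) * (256 * 4 ^ K) < Fintype.card ι := by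
      refine lt_of_lt_of_le ?_ hι
      calc ((70 + K) * 4 ^ q) * (256 * 4 ^ K) = ((70 + K) * 256 * 4 ^ K) * 4 ^ q := by ring
        _ < 4 ^ q * 4 ^ q := Nat.mul_lt_mul_of_pos_right hqK (by positivity)
        _ = 16 ^ q := by
          rw [← mul_pow]
          norm_num
    rw [h4, mul_one_div, lt_div_iff₀ (by positivity)]
    exact_mod_cast h5
  obtain ⟨ℓ, hℓ⟩ := exists_forall_sum_sub_mean_lt (levelWeight_nonneg K) (sum_levelWeight K) G
    (by norm_num : (0 : ℝ) < 4) (by positivity : (0 : ℝ) < 1 / 2 ^ K)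
    (by have : (1 : ℝ) / 2 ^ K ≤ 1 := div_le_self zero_le_one (one_le_pow₀ one_le_two)
        linarith) hG hcard
  refine ⟨ℓ, fun f hf => ?_, ?_⟩
  · have h := hℓ _ (Finset.mem_insert_of_mem (Finset.mem_image_of_mem _ hf))
    rw [Finset.sum_sub_distrib] at h
    linarith
  · have h := hℓ _ (Finset.mem_insert_self _ _)
    simp only [mul_neg, Finset.sum_neg_distrib, sub_neg_eq_add] at h
    rw [Finset.sum_add_distrib, Finset.sum_neg_distrib, Finset.sum_const, Finset.card_univ,
      nsmul_eq_mul] at h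
    have h1 := mul_le_mul_of_nonneg_left (sum_levelWeight_mul_value K)
      (Nat.cast_nonneg (α := ℝ) (Fintype.card ι))
    have e : (Fintype.card ι : ℝ) * (((K : ℝ) - 1) / 2 ^ (K + 1)) =
        Fintype.card ι * (((K : ℝ) + 1) / 2 ^ (K + 1)) - Fintype.card ι * (1 / 2 ^ K) := by
      rw [pow_succ]
      field_simp
      ring
    rw [e]
    linarith

/-- Under an assignment as in `exists_levels`, the virtual values of the truncated costs of every
individually rational protocol have a small average. -/
lemma sum_virtual_truncCost_le [Fintype ι] {A : ι → Finset (Fin n)} {q K : ℕ} (hq : 0 < q)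
    {ℓ : ι → Fin (K + 1)}
    (hℓ : ∀ f ∈ costNet A q K, ∑ k, (2 * f (k, ℓ k + 1) - f (k, ℓ k)) ≤
        Fintype.card ι * (1 / 2 ^ K) +
          ∑ k, ∑ l, levelWeight K l * (2 * f (k, l + 1) - f (k, l)))
    {P : AuctionProtocol n} (hP : P.IsIR) :
    ∑ k, (2 * (truncCost (A k) (levelVal (ℓ k + 1)) q P).toReal -
      (truncCost (A k) (levelVal (ℓ k)) q P).toReal) ≤ Fintype.card ι * (6 / 2 ^ K) := by
  rcases isEmpty_or_nonempty ι with hι | ⟨⟨k₀⟩⟩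
  · simp
  set N : ℝ := (Fintype.card ι : ℝ)
  let C : ι → ℕ → ℝ := fun k j => (truncCost (A k) (levelVal j) q P).toReal
  have hC2 : ∀ k j, truncCost (A k) (levelVal j) q P ≤ 2 * levelVal j := fun k j =>
    truncCost_le_two_mul hP (A k) (levelVal j) q
  have hCtop : ∀ k j, truncCost (A k) (levelVal j) q P ≠ ∞ := fun k j =>
    ne_top_of_le_ne_top (ENNReal.mul_ne_top (by simp) ENNReal.coe_ne_top) (hC2 k j)
  have hJ : 0 < 12 * q * 2 ^ K := by positivity
  have herr : (q : ℝ) * (2 / ((12 * q * 2 ^ K : ℕ) : ℝ)) = 1 / (6 * 2 ^ K) := by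
    have : (q : ℝ) ≠ 0 := by positivity
    push_cast
    field_simp
    norm_num
  rcases isNear_truncCost (A := fun θ : ι × ℕ => A θ.1) (y := fun θ => levelVal θ.2)
    (fun θ => levelVal_le_two θ.2) hJ q P with h | ⟨c, f, hf, h⟩
  · exact absurd (h (k₀, 0)) (hCtop k₀ 0)
  rw [herr] at h
  set ε : ℝ := 1 / (6 * 2 ^ K)
  have hε : (1 : ℝ) / 2 ^ K = 6 * ε := by
    simp only [ε]
    field_simp
  have hf' : ∀ k j, C k j - c - ε ≤ f (k, j) ∧ f (k, j) ≤ C k j - c + ε := by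
    intro k j
    have := abs_le.1 (h (k, j)).2
    simp only [C]
    constructor <;> linarith [this.1, this.2]
  have h1 := hℓ f hf
  have h2 : ∑ k, (2 * C k (ℓ k + 1) - C k (ℓ k)) ≤
      ∑ k, (2 * f (k, ℓ k + 1) - f (k, ℓ k)) + N * (c + 3 * ε) := by
    have : N * (c + 3 * ε) = ∑ _k : ι, (c + 3 * ε) := by
      rw [Finset.sum_const, Finset.card_univ, nsmul_eq_mul]
    rw [this, ← Finset.sum_add_distrib]
    refine Finset.sum_le_sum fun k _ => ?_
    linarith [(hf' k (ℓ k + 1)).1, (hf' k (ℓ k)).2]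
  have h3 : ∀ k, ∑ l : Fin (K + 1), levelWeight K l * (2 * f (k, l + 1) - f (k, l)) ≤
      4 * (6 * ε) - c + 3 * ε := by
    intro k
    have h4 : ∑ l : Fin (K + 1), levelWeight K l * (2 * f (k, l + 1) - f (k, l)) ≤
        ∑ l : Fin (K + 1), (levelWeight K l * (2 * C k (l + 1) - C k l) +
          levelWeight K l * (3 * ε - c)) := by
      refine Finset.sum_le_sum fun l _ => ?_
      rw [← mul_add]
      refine mul_le_mul_of_nonneg_left ?_ (levelWeight_nonneg K l)
      linarith [(hf' k (l + 1)).2, (hf' k l).1]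
    rw [Finset.sum_add_distrib, ← Finset.sum_mul, sum_levelWeight, one_mul,
      sum_levelWeight_mul_virtual] at h4
    have h5 : C k (K + 1) ≤ 2 * (1 / 2 ^ K) := by
      have := ENNReal.toReal_mono (ENNReal.mul_ne_top (by simp) ENNReal.coe_ne_top)
        (hC2 k (K + 1))
      rw [ENNReal.toReal_mul, ENNReal.coe_toReal, coe_levelVal_succ] at this
      simpa using this
    have h6 : (2 ^ (K + 1) * C k (K + 1) - C k 0) / (2 ^ (K + 1) - 1) ≤ 4 * (1 / 2 ^ K) := by
      rw [div_le_iff₀ (levelNorm_pos K)]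
      have h7 : (2 : ℝ) ^ (K + 1) * C k (K + 1) ≤ 4 := by
        calc (2 : ℝ) ^ (K + 1) * C k (K + 1) ≤ 2 ^ (K + 1) * (2 * (1 / 2 ^ K)) := by gcongr
          _ = 4 := by
            rw [pow_succ]
            field_simp
            norm_num
      have h8 : (4 : ℝ) = 4 * (1 / 2 ^ K) * 2 ^ K := by field_simp
      have h9 : 4 * (1 / 2 ^ K) * (2 : ℝ) ^ K ≤ 4 * (1 / 2 ^ K) * (2 ^ (K + 1) - 1) :=
        mul_le_mul_of_nonneg_left (levelNorm_ge K) (by positivity)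
      have h10 : 0 ≤ C k 0 := ENNReal.toReal_nonneg
      linarith
    rw [hε] at h6
    linarith
  have h4 : ∑ k, ∑ l : Fin (K + 1), levelWeight K l * (2 * f (k, l + 1) - f (k, l)) ≤
      N * (4 * (6 * ε) - c + 3 * ε) := by
    refine (Finset.sum_le_sum fun k _ => h3 k).trans (le_of_eq ?_)
    rw [Finset.sum_const, Finset.card_univ, nsmul_eq_mul]
  have h5 : (6 : ℝ) / 2 ^ K = 6 * (6 * ε) := by
    rw [← hε]
    ring
  rw [hε] at h1
  rw [h5]
  refine h2.trans ?_
  linarith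

end Assignment

/-! ### Protocols with few bits -/

namespace AuctionProtocol

variable {n : ℕ}

lemma exAnteBits_le_commComplexity (P : AuctionProtocol n) (D : PMF (BundleValuation n)) :
    P.exAnteBits D ≤ P.commComplexity := by
  calc P.exAnteBits D ≤ ∑' v, D v * P.commComplexity := by
        refine ENNReal.tsum_le_tsum fun v => ?_
        gcongr
        exact le_iSup P.expBits (P.suggested v)
    _ = P.commComplexity := by rw [ENNReal.tsum_mul_right, D.tsum_coe, one_mul]

/-- A protocol for a prior as in `exists_levels` that uses few bits has a small revenue. -/
lemma revenue_hitPrior_le {ι : Type*} [Fintype ι] [Nonempty ι] {A : ι → Finset (Fin n)} {q K : ℕ}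
    (hq : 0 < q) {ℓ : ι → Fin (K + 1)}
    (hℓ : ∀ f ∈ costNet A q K, ∑ k, (2 * f (k, ℓ k + 1) - f (k, ℓ k)) ≤
        Fintype.card ι * (1 / 2 ^ K) +
          ∑ k, ∑ l, levelWeight K l * (2 * f (k, l + 1) - f (k, l)))
    {P : AuctionProtocol n} {δ : ℝ≥0} (hδ : (δ : ℝ) = 1 / 2 ^ (K + 1))
    (hP : P.IsAlmostIC (hitPrior A fun k => levelVal (ℓ k + 1)) δ)
    {β : ℝ≥0} (hβ : (β : ℝ) ≤ q * (1 / 2 ^ (K + 1)))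
    (hbits : P.exAnteBits (hitPrior A fun k => levelVal (ℓ k + 1)) ≤ β) :
    P.revenue (hitPrior A fun k => levelVal (ℓ k + 1)) ≤ ENNReal.ofReal (8 / 2 ^ K) := by
  set N : ℝ := (Fintype.card ι : ℝ)
  have hN : 0 < N := by
    simp only [N]
    exact_mod_cast Fintype.card_pos
  have hN0 : (Fintype.card ι : ℝ≥0∞) ≠ 0 := by
    exact_mod_cast Fintype.card_ne_zero
  have hNt : (Fintype.card ι : ℝ≥0∞) ≠ ∞ := ENNReal.natCast_ne_top _
  let s : ι → BuyerStrategy := fun k => P.suggested (hitVal (A k) (levelVal (ℓ k + 1)))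
  let T : ι → ℝ≥0∞ := fun k => runProb q P (s k)
  have hTt : ∀ k, T k ≠ ∞ := fun k =>
    ne_top_of_le_ne_top ENNReal.one_ne_top (runProb_le_one q P (s k))
  have hCt : ∀ k j, truncCost (A k) (levelVal j) q P ≠ ∞ := fun k j =>
    ne_top_of_le_ne_top (ENNReal.mul_ne_top (by simp) ENNReal.coe_ne_top)
      (truncCost_le_two_mul hP.2.1 (A k) (levelVal j) q)
  have hpay : ∀ k, P.expPayment (s k) + truncCost (A k) (levelVal (ℓ k)) q P ≤
      2 * truncCost (A k) (levelVal (ℓ k + 1)) q P + 2 * δ + 2 * T k := by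
    intro k
    have h := expPayment_add_truncCost_le hP
      ((mem_support_hitPrior A fun k => levelVal (ℓ k + 1)).2 ⟨k, rfl⟩) q
    rw [two_mul_levelVal_succ] at h
    refine h.trans ?_
    gcongr
    calc (2 : ℝ≥0∞) * (levelVal (ℓ k + 1) : ℝ≥0∞) ≤ 2 * 1 := by
          gcongr
          exact_mod_cast levelVal_succ_le_one _
      _ = 2 := mul_one _
  have hrt : ∀ k, 2 * truncCost (A k) (levelVal (ℓ k + 1)) q P + 2 * δ + 2 * T k ≠ ∞ := by
    intro k
    refine ENNReal.add_ne_top.2 ⟨ENNReal.add_ne_top.2 ⟨?_, ?_⟩, ?_⟩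
    · exact ENNReal.mul_ne_top (by simp) (hCt k _)
    · exact ENNReal.mul_ne_top (by simp) ENNReal.coe_ne_top
    · exact ENNReal.mul_ne_top (by simp) (hTt k)
  have hpt : ∀ k, P.expPayment (s k) ≠ ∞ := fun k =>
    ne_top_of_le_ne_top (hrt k) (le_self_add.trans (hpay k))
  have hpay' : ∀ k, (P.expPayment (s k)).toReal ≤
      (2 * (truncCost (A k) (levelVal (ℓ k + 1)) q P).toReal -
        (truncCost (A k) (levelVal (ℓ k)) q P).toReal) + (2 * δ + 2 * (T k).toReal) := by
    intro k
    have h := ENNReal.toReal_mono (hrt k) (hpay k)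
    rw [ENNReal.toReal_add (hpt k) (hCt k _),
      ENNReal.toReal_add (ENNReal.add_ne_top.2 ⟨ENNReal.mul_ne_top (by simp) (hCt k _),
        ENNReal.mul_ne_top (by simp) ENNReal.coe_ne_top⟩) (ENNReal.mul_ne_top (by simp) (hTt k)),
      ENNReal.toReal_add (ENNReal.mul_ne_top (by simp) (hCt k _))
        (ENNReal.mul_ne_top (by simp) ENNReal.coe_ne_top)] at h
    simp only [ENNReal.toReal_mul, ENNReal.toReal_ofNat, ENNReal.coe_toReal] at h
    linarith
  have hT : ∑ k, (T k).toReal ≤ N * (1 / 2 ^ (K + 1)) := by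
    have h1 : ∑ k, (q : ℝ≥0∞) * T k ≤ Fintype.card ι * β := by
      rw [exAnteBits, tsum_hitPrior_mul _ _ fun v => P.expBits (P.suggested v)] at hbits
      calc ∑ k, (q : ℝ≥0∞) * T k ≤ ∑ k, P.expBits (s k) :=
            Finset.sum_le_sum fun k _ => mul_runProb_le_expBits hP.1 q (s k)
        _ = Fintype.card ι * ((Fintype.card ι : ℝ≥0∞)⁻¹ * ∑ k, P.expBits (s k)) := by
            rw [← mul_assoc, ENNReal.mul_inv_cancel hN0 hNt, one_mul]
        _ ≤ _ := by gcongr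
    have h2 := ENNReal.toReal_mono (ENNReal.mul_ne_top hNt ENNReal.coe_ne_top) h1
    rw [ENNReal.toReal_sum fun k _ => ENNReal.mul_ne_top (ENNReal.natCast_ne_top q) (hTt k)] at h2
    simp only [ENNReal.toReal_mul, ENNReal.toReal_natCast, ENNReal.coe_toReal] at h2
    rw [← Finset.mul_sum] at h2
    have hq' : (0 : ℝ) < q := by exact_mod_cast hq
    refine le_of_mul_le_mul_left (h2.trans ?_) hq'
    have := mul_le_mul_of_nonneg_left hβ hN.le
    calc N * (β : ℝ) ≤ _ := this
      _ = _ := by ring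
  -- the virtual values contribute `6`, the slack `δ` and the truncation `1` each, in units of `2⁻ᴷ`
  have hvirt := sum_virtual_truncCost_le hq hℓ hP.2.1
  have hsum : ∑ k, (P.expPayment (s k)).toReal ≤ N * (8 / 2 ^ K) := by
    refine (Finset.sum_le_sum fun k _ => hpay' k).trans ?_
    rw [Finset.sum_add_distrib, Finset.sum_add_distrib, Finset.sum_const, Finset.card_univ,
      nsmul_eq_mul, ← Finset.mul_sum, hδ]
    have e : N * (8 / 2 ^ K) =
        N * (6 / 2 ^ K) + (N * (2 * (1 / 2 ^ (K + 1))) + 2 * (N * (1 / 2 ^ (K + 1)))) := by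
      rw [pow_succ]
      field_simp
      norm_num
    rw [e]
    gcongr
  rw [revenue, tsum_hitPrior_mul _ _ fun v => P.expPayment (P.suggested v),
    ENNReal.inv_mul_le_iff hN0 hNt, ← ENNReal.ofReal_natCast, ← ENNReal.ofReal_mul hN.le]
  refine le_trans (le_of_eq ?_) (ENNReal.ofReal_le_ofReal hsum)
  rw [ENNReal.ofReal_sum_of_nonneg fun k _ => ENNReal.toReal_nonneg]
  exact Finset.sum_congr rfl fun k _ => (ENNReal.ofReal_toReal (hpt k)).symm

end AuctionProtocol

theorem mainTheorem3 (τ : ℝ≥0) (hτ : 0 < τ) :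
    ∃ (c δ : ℝ≥0) (n₀ : ℕ), 0 < c ∧ 0 < δ ∧
      ∀ n : ℕ, n₀ ≤ n →
        ∃ D : PMF (BundleValuation n),
          D.support.Finite ∧
          (∀ v ∈ D.support, IsUnitDemand v ∧ ∀ S : Finset (Fin n), v S ≤ 1) ∧
          ∀ P : AuctionProtocol n,
            P.IsAlmostIC D δ →
            (τ : ℝ≥0∞) * optimalRevenue D ≤ P.revenue D →
              (c : ℝ≥0∞) * (n : ℝ≥0∞) ≤ P.exAnteBits D ∧
              (c : ℝ≥0∞) * (n : ℝ≥0∞) ≤ P.commComplexity := by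
  have hτ' : (0 : ℝ) < τ := hτ
  obtain ⟨K, hK⟩ := exists_nat_gt (128 / (τ : ℝ) + 1)
  have hτK : 128 < τ * ((K : ℝ) - 1) := by
    rw [← div_lt_iff₀' hτ']
    linarith
  -- With `q = n / 32`, the codewords have length `16 * q`, the trees are cut off at depth `q`, and
  -- `c * n ≤ q / 2 ^ (K + 1)` as `n ≤ 64 * q`. The size of `n` makes `16 ^ q`, the number of types,
  -- exceed the logarithm of the size of the net by the factor that the union bound needs.
  refine ⟨1 / (64 * 2 ^ (K + 1)), 1 / 2 ^ (K + 1), 32 * ((70 + K) * 256 * 4 ^ K),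
    by positivity, by positivity, fun n hn => ?_⟩
  obtain ⟨q, hq⟩ : ∃ q, q = n / 32 := ⟨_, rfl⟩
  have hqK' : (70 + K) * 256 * 4 ^ K ≤ q := by omega
  have hqK : (70 + K) * 256 * 4 ^ K < 4 ^ q := hqK'.trans_lt (Nat.lt_pow_self (by norm_num))
  have hq0 : 0 < q := lt_of_lt_of_le (by positivity) hqK'
  obtain ⟨C, hC, hCdist⟩ := exists_code q
  obtain ⟨e⟩ : Nonempty (Fin (16 * q) × Bool ↪ Fin n) := by
    refine Function.Embedding.nonempty_of_card_le ?_
    simp only [Fintype.card_prod, Fintype.card_fin, Fintype.card_bool]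
    omega
  let A : C → Finset (Fin n) := fun a => wordSet e a.1
  have hcard : 16 ^ q ≤ Fintype.card C := by rwa [Fintype.card_coe]
  have : Nonempty C := Fintype.card_pos_iff.1 (lt_of_lt_of_le (by positivity) hcard)
  obtain ⟨ℓ, hℓ, hval⟩ := exists_levels A (K := K) hq0 (by omega) hqK hcard
  refine ⟨hitPrior A fun k => levelVal (ℓ k + 1), finite_support_hitPrior _ _, ?_, ?_⟩
  · intro v hv
    obtain ⟨k, rfl⟩ := (mem_support_hitPrior _ _).1 hv
    exact ⟨isUnitDemand_hitVal _ _, fun S =>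
      (hitVal_le _ _ S).trans (levelVal_succ_le_one _)⟩
  intro P hP hrev
  suffices h : ((1 / (64 * 2 ^ (K + 1)) : ℝ≥0) : ℝ≥0∞) * (n : ℝ≥0∞) ≤
      P.exAnteBits (hitPrior A fun k => levelVal (ℓ k + 1)) from
    ⟨h, h.trans (P.exAnteBits_le_commComplexity _)⟩
  by_contra! hbits
  have hlow := AuctionProtocol.revenue_hitPrior_le hq0 hℓ (by push_cast; rfl) hP
    (β := 1 / (64 * 2 ^ (K + 1)) * n) (by
      have : (n : ℝ) ≤ 64 * q := by exact_mod_cast (by omega : n ≤ 64 * q)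
      push_cast
      calc 1 / (64 * 2 ^ (K + 1)) * (n : ℝ) ≤ 1 / (64 * 2 ^ (K + 1)) * (64 * q) := by gcongr
        _ = q * (1 / 2 ^ (K + 1)) := by field_simp)
    (by rw [ENNReal.coe_mul, ENNReal.coe_natCast]; exact hbits.le)
  have hopt := le_optimalRevenue_hitPrior (A := A) (x := fun k => levelVal (ℓ k + 1))
    (fun k => levelVal_ne_zero _) (m := 16 * q) (by omega) (fun k => card_wordSet e k.1)
    (fun j k hjk => by
      have h1 := card_wordSet_inter_add_hammingDist_le e j.1 k.1
      have h2 := hCdist j.1 j.2 k.1 k.2 (fun h => hjk (Subtype.ext h))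
      simp only [A]
      omega)
  have hopt' : ENNReal.ofReal (((K : ℝ) - 1) / (16 * 2 ^ K)) ≤
      optimalRevenue (hitPrior A fun k => levelVal (ℓ k + 1)) := by
    refine le_trans ?_ hopt
    rw [← ENNReal.div_eq_inv_mul, ENNReal.le_div_iff_mul_le
      (.inl (by exact_mod_cast Fintype.card_ne_zero)) (.inl (ENNReal.natCast_ne_top _)),
      ← ENNReal.ofReal_natCast, ← ENNReal.ofReal_mul' (by positivity), ← ENNReal.ofNNReal_finsetSum,
      ← ENNReal.ofReal_coe_nnreal]
    refine ENNReal.ofReal_le_ofReal ?_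
    push_cast
    simp only [coe_levelVal_succ]
    rw [← Finset.sum_div, le_div_iff₀ (by norm_num)]
    refine le_trans (le_of_eq ?_) hval
    rw [pow_succ]
    field_simp
    ring
  have hfin : ENNReal.ofReal (τ * (((K : ℝ) - 1) / (16 * 2 ^ K))) ≤
      ENNReal.ofReal (8 / 2 ^ K) := by
    rw [ENNReal.ofReal_mul hτ'.le, ENNReal.ofReal_coe_nnreal]
    exact ((mul_le_mul_right hopt' _).trans hrev).trans hlow
  rw [ENNReal.ofReal_le_ofReal_iff (by positivity)] at hfin
  have h1 : (τ : ℝ) * (((K : ℝ) - 1) / (16 * 2 ^ K)) =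
      τ * ((K : ℝ) - 1) / 16 / 2 ^ K := by
    field_simp
  rw [h1, div_le_div_iff_of_pos_right (by positivity)] at hfin
  linarith
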